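/- **Setting.** Let $Y = X\beta + \epsilon$ with a fixed $n\times p$ design $X$, $\beta\in\mathbb{R}^p$, $S=\{j:\beta_j\neq 0\}$, $s=|S|$, and independent errors $\epsilon_1,\dots,\epsilon_n$ with mean $0$, variance $\sigma^2$ and $E|\epsilon_l|^{2k}\le M$ for some real $k>0$. The $n$ observations are partitioned into $m\ge 1$ subsets $(Y^{(i)},X^{(i)})$ of equal size $r=n/m$. Fix constants $V_1,V_2,c_0,c_1,c_2,\eta>0$ and $0\le\iota<\tau\le 1$ with $c_0<2c_2V_2/\sqrt{c_1}$, and suppose that every subset satisfies: * (A.1) $\frac1r\|x_j^{(i)}\|_2^2\le V_1$ for every column $x^{(i)}_j$ of $X^{(i)}$, and $\lambda_{\min}\big(\frac1r X_S^{(i)T}X^{(i)}_S\big)\ge V_2$; * (A.2) $s\le c_1r^{\iota}$ and $\min_{j\in S}|\beta_j|\ge c_2r^{-(1-\tau)/2}$; * (A.3) $\big|X_{S^c}^{(i)T}X_S^{(i)}(X_S^{(i)T}X_S^{(i)})^{-1}\mathrm{sign}(\beta_S)\big|<1-\eta$ entrywise. For each $i$ let $\hat\beta^{(i)}$ be any minimizer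 of $\frac1r\|Y^{(i)}-X^{(i)}b\|_2^2+\lambda\|b\|_1$ with $$\lambda=c_0\,(n/m)^{-\frac{\iota-\tau+1}{2}},$$ and let $\gamma^{(i)}\in\{0,1\}^p$ indicate its non-zero coordinates. Let $\gamma$ be any (measurable) minimizer of $\sum_{i=1}^m\|\gamma-\gamma^{(i)}\|_1$ over $\{0,1\}^p$ (a coordinatewise median, i.e. majority vote with ties broken arbitrarily), and $M_\gamma\subseteq\{1,\dots,p\}$ the corresponding model. Let $\bar\beta$ be the average over $i$ of the least squares estimators $(X_\gamma^{(i)T}X_\gamma^{(i)})^{-1}X_\gamma^{(i)T}Y^{(i)}$, extended by $0$ outside $M_\gamma$. **Theorem.** There is a constant $C_0>0$, depending only on $k,\tau,\iota,V_1,V_2,c_0,c_1,c_2,\eta,\sigma,M$, such that the following holds whenever $p\le n^\alpha$ for some $\alpha<k(\tau-\iota)$, $\delta\in(0,1/2)$, $n\ge(2C_0p)^{1/(k\tau-k\iota)}$ and $$m=\Big\lfloor (\delta/C_0)^{1/(k\tau-k\iota)}\,n/p^{1/(k\tau-k\iota)}\Big\rfloor\ge 1 .$$ With $$\rho=\exp\Big\{-\frac{(1/2-\delta)^2}{2(1-\delta)}\Big(\frac{\delta}{C_0}\Big)^{1/(k\tau-k\iota)}n^{1-\alpha/(k\tau-k\iota)}\Big\}$$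 one has $P(M_\gamma=S)\ge 1-\rho$. Moreover, for every constant $C_0'>0$ with $\min_i\lambda_{\min}(X_\gamma^{(i)T}X_\gamma^{(i)}/r)\ge C_0'$ almost surely, $\|\bar\beta-\beta\|_2^2$ is integrable and $$E\|\bar\beta-\beta\|_2^2\le\frac{\sigma^2V_2^{-1}s}{n}+\rho\Big((1+2C_0'^{-1}sV_1)\|\beta\|_2^2+C_0'^{-1}\sigma^2\Big).$$ (For $\delta=1/4$ the constant $\frac{(1/2-\delta)^2}{2(1-\delta)}$ equals $1/24$.) -/

import Mathlib

open MeasureTheory ProbabilityTheory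

noncomputable section

namespace Message

variable {r p m : ℕ}

/-- The model of a coefficient vector: the set of features whose coefficient is non-zero. -/
def supp (b : Fin p → ℝ) : Finset (Fin p) := Finset.univ.filter (fun j => b j ≠ 0)

/-- Squared Euclidean norm. -/
def sqNorm {κ : Type*} [Fintype κ] (v : κ → ℝ) : ℝ := ∑ j, (v j) ^ 2

/-- `X_G`: the columns of `X` with index in `G`. -/
def cols (X : Matrix (Fin r) (Fin p) ℝ) (G : Finset (Fin p)) : Matrix (Fin r) G ℝ :=
  X.submatrix id Subtype.val

/-- `X_Gᵀ X_G`. -/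
def gram (X : Matrix (Fin r) (Fin p) ℝ) (G : Finset (Fin p)) : Matrix G G ℝ :=
  (cols X G).transpose * cols X G

/-- `λ_min (A) ≥ c`: every eigenvalue of `A` is at least `c` (used for real symmetric `A`;
no condition if `A` is the empty matrix). -/
def MinEigenvalueGE {κ : Type*} [Fintype κ] [DecidableEq κ] (A : Matrix κ κ ℝ) (c : ℝ) : Prop :=
  ∀ t ∈ spectrum ℝ A, c ≤ t

/-- Consistency condition for estimation, on a subset with `r` observations and design `X`. -/
structure CondA1 (V₁ V₂ : ℝ) (X : Matrix (Fin r) (Fin p) ℝ) (β : Fin p → ℝ) : Prop where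
  col_le : ∀ j, (1 / (r : ℝ)) * ∑ l, (X l j) ^ 2 ≤ V₁
  eig_ge : MinEigenvalueGE ((1 / (r : ℝ)) • gram X (supp β)) V₂

/-- Sparsity and minimal signal strength, on a subset with `r` observations. -/
structure CondA2 (c₁ c₂ ι τ : ℝ) (r : ℕ) (β : Fin p → ℝ) : Prop where
  sparse : ((supp β).card : ℝ) ≤ c₁ * (r : ℝ) ^ ι
  signal : ∀ j ∈ supp β, c₂ * (r : ℝ) ^ (-((1 - τ) / 2)) ≤ |β j|

/-- The strong irrepresentable condition
`|X_{Sᶜ}ᵀ X_S (X_Sᵀ X_S)⁻¹ sign(β_S)| < 1 - η`, entrywise. -/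
def CondA3 (η : ℝ) (X : Matrix (Fin r) (Fin p) ℝ) (β : Fin p → ℝ) : Prop :=
  ∀ j : ((supp β)ᶜ : Finset (Fin p)),
    |((cols X (supp β)ᶜ).transpose * cols X (supp β) * (gram X (supp β))⁻¹).mulVec
        (fun a => Real.sign (β a)) j| < 1 - η

/-- Independent centred errors with variance `σ²` and `2k`-th absolute moment at most `M`. -/
structure ErrorModel {Ω : Type*} [MeasurableSpace Ω] (μ : Measure Ω) {n : ℕ}
    (k σ M : ℝ) (ε : Fin n → Ω → ℝ) : Prop where
  meas : ∀ l, Measurable (ε l)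
  indep : iIndepFun ε μ
  sq_integrable : ∀ l, MemLp (ε l) 2 μ
  mean : ∀ l, ∫ ω, ε l ω ∂μ = 0
  var : ∀ l, variance (ε l) μ = σ ^ 2
  moment_integrable : ∀ l, Integrable (fun ω => |ε l ω| ^ (2 * k)) μ
  moment_le : ∀ l, ∫ ω, |ε l ω| ^ (2 * k) ∂μ ≤ M

/-- `(1/r) ‖Y - X b‖₂² + lam ‖b‖₁`. -/
def lassoLoss (lam : ℝ) (X : Matrix (Fin r) (Fin p) ℝ) (Y : Fin r → ℝ) (b : Fin p → ℝ) : ℝ :=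
  (1 / (r : ℝ)) * sqNorm (Y - X.mulVec b) + lam * ∑ j, |b j|

/-- `b` is a Lasso estimate (a minimizer of the Lasso loss). -/
def IsLasso (lam : ℝ) (X : Matrix (Fin r) (Fin p) ℝ) (Y : Fin r → ℝ) (b : Fin p → ℝ) : Prop :=
  ∀ b', lassoLoss lam X Y b ≤ lassoLoss lam X Y b'

/-- `G` is a median model of the models `γ 1, …, γ m`: it minimizes `∑ᵢ ‖G - γ i‖₁` over all
models. For 0/1 inclusion vectors the `ℓ¹` distance is the size of the symmetric difference. -/
def IsMedianModel (γ : Fin m → Finset (Fin p)) (G : Finset (Fin p)) : Prop :=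
  ∀ H : Finset (Fin p), ∑ i, (symmDiff G (γ i)).card ≤ ∑ i, (symmDiff H (γ i)).card

/-- Ordinary least squares in the model `G`, `(X_Gᵀ X_G)⁻¹ X_Gᵀ Y`, extended by zero outside `G`. -/
def ols (X : Matrix (Fin r) (Fin p) ℝ) (Y : Fin r → ℝ) (G : Finset (Fin p)) : Fin p → ℝ :=
  fun j => if h : j ∈ G then
    ((gram X G)⁻¹.mulVec ((cols X G).transpose.mulVec Y)) ⟨j, h⟩ else 0

/-- Design matrix of subset `i` under the partition `e` of the `n` observations into `m` subsets
of `r` observations each. -/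
def subX {n : ℕ} (e : Fin n ≃ Fin m × Fin r) (X : Matrix (Fin n) (Fin p) ℝ) (i : Fin m) :
    Matrix (Fin r) (Fin p) ℝ :=
  X.submatrix (fun l => e.symm (i, l)) id

/-- Response vector of subset `i`. -/
def subY {n : ℕ} (e : Fin n ≃ Fin m × Fin r) (Y : Fin n → ℝ) (i : Fin m) : Fin r → ℝ :=
  fun l => Y (e.symm (i, l))

/-- The aggregated estimator: the average over the subsets of the least squares estimates in the
model `G`. -/
def aggregated {n : ℕ} (e : Fin n ≃ Fin m × Fin r) (X : Matrix (Fin n) (Fin p) ℝ)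
    (Y : Fin n → ℝ) (G : Finset (Fin p)) : Fin p → ℝ :=
  fun j => (∑ i, ols (subX e X i) (subY e Y i) G j) / (m : ℝ)

/-- `exp(-(1/2-δ)²/(2(1-δ)) (δ/C₀)^{1/(kτ-kι)} n^{1-α/(kτ-kι)})`. -/
def failBound (C₀ δ k τ ι α : ℝ) (n : ℕ) : ℝ :=
  Real.exp (-((1 / 2 - δ) ^ 2 / (2 * (1 - δ)) * (δ / C₀) ^ (k * τ - k * ι)⁻¹ *
    (n : ℝ) ^ (1 - α * (k * τ - k * ι)⁻¹)))

end Message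

end

/-!
In each block, the primal–dual construction shows that the Lasso selects exactly `S` unless one of
`p` linear forms in the errors of the block exceeds a threshold. A moment inequality of Rosenthal
type bounds the probability of the latter by `p * K * (D * r ^ (-(τ - ι))) ^ k`, which the choice of
`m` makes at most `1 / 64`. The blocks are independent, so by exponential tilting a majority of them
fails with probability at most `(1 / 4) ^ m`, and the energy of the errors of a single block,
integrated over that event, is smaller than its mean by the same factor. Off the event the median
model is `S` and the estimator is the average of the least squares fits in the true model; on it the
risk is controlled by the energy of the errors.
-/

open scoped ENNReal

namespace Message

section Moment

lemma rpow_mul_self_sub_le {e a b : ℝ} (he : 0 ≤ e) (hb : 0 ≤ b) (hab : b ≤ a) :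
    a ^ e * a - b ^ e * b ≤ (e + 1) * a ^ e * (a - b) := by
  rcases hb.eq_or_lt with rfl | hb
  · have : 0 ≤ a ^ e := Real.rpow_nonneg hab _
    nlinarith [mul_nonneg he (mul_nonneg this hab)]
  have ha : 0 < a := hb.trans_le hab
  have bernoulli : 1 + (e + 1) * (b / a - 1) ≤ (b / a) ^ (e + 1) := by
    have := one_add_mul_self_le_rpow_one_add (s := b / a - 1) (p := e + 1)
      (by linarith [div_pos hb ha]) (by linarith)
    rwa [add_sub_cancel] at this
  rw [Real.div_rpow hb.le ha.le, Real.rpow_add_one hb.ne', Real.rpow_add_one ha.ne',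
    le_div_iff₀ (by positivity)] at bernoulli
  have expand : (1 + (e + 1) * (b / a - 1)) * (a ^ e * a) =
      a ^ e * a + (e + 1) * a ^ e * (b - a) := by
    field_simp
  linarith

lemma abs_rpow_mul_self_sub_le {e a b R : ℝ} (he : 0 ≤ e) (hab : b ≤ a) (ha : |a| ≤ R)
    (hb : |b| ≤ R) : |a| ^ e * a - |b| ^ e * b ≤ (e + 1) * R ^ e * (a - b) := by
  have hRa : |a| ^ e ≤ R ^ e := Real.rpow_le_rpow (abs_nonneg a) ha he
  have hRb : |b| ^ e ≤ R ^ e := Real.rpow_le_rpow (abs_nonneg b) hb he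
  have hsub : 0 ≤ a - b := sub_nonneg.2 hab
  rcases le_total 0 b with hb0 | hb0
  · rw [abs_of_nonneg (hb0.trans hab)] at hRa ⊢
    rw [abs_of_nonneg hb0]
    exact (rpow_mul_self_sub_le he hb0 hab).trans (by gcongr)
  rcases le_total a 0 with ha0 | ha0
  · rw [abs_of_nonpos hb0] at hRb ⊢
    rw [abs_of_nonpos ha0]
    have h := rpow_mul_self_sub_le he (neg_nonneg.2 ha0) (neg_le_neg hab)
    have : (e + 1) * (-b) ^ e * (a - b) ≤ (e + 1) * R ^ e * (a - b) := by gcongr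
    linarith
  · have hR : 0 ≤ R ^ e := (Real.rpow_nonneg (abs_nonneg a) e).trans hRa
    nlinarith [mul_nonneg he (mul_nonneg hR hsub), mul_le_mul_of_nonneg_right hRa ha0,
      mul_le_mul_of_nonneg_right hRb (neg_nonneg.2 hb0)]

lemma abs_rpow_add_tangent_le {q : ℝ} (hq : 1 < q) (t x : ℝ) :
    |t| ^ q + q * (|t| ^ (q - 2) * t) * (x - t) ≤ |x| ^ q := by
  have hconj : q.HolderConjugate (q / (q - 1)) := Real.HolderConjugate.conjExponent hq
  rcases eq_or_ne t 0 with rfl | ht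
  · simpa [Real.zero_rpow (by linarith : q ≠ 0)] using Real.rpow_nonneg (abs_nonneg x) q
  have ht' : 0 < |t| := abs_pos.2 ht
  have hsq : |t| ^ (q - 2) * t * t = |t| ^ q := by
    rw [mul_assoc, ← abs_mul_abs_self, ← pow_two, ← Real.rpow_natCast, ← Real.rpow_add ht']
    norm_num
  have young : |t| ^ (q - 2) * t * x ≤ |x| ^ q / q + |t| ^ q / (q / (q - 1)) := by
    have h := Real.young_inequality x (|t| ^ (q - 2) * t) hconj
    have habs : |(|t| ^ (q - 2) * t)| = |t| ^ (q - 1) := by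
      rw [abs_mul, abs_of_nonneg (by positivity), ← Real.rpow_add_one ht'.ne']
      ring_nf
    rw [habs, ← Real.rpow_mul ht'.le, mul_div_cancel₀ _ (by linarith)] at h
    linarith
  have hq0 : q ≠ 0 := by linarith
  have := mul_le_mul_of_nonneg_left young (by linarith : 0 ≤ q)
  have expand : q * (|x| ^ q / q + |t| ^ q / (q / (q - 1))) = |x| ^ q + (q - 1) * |t| ^ q := by
    field_simp
  nlinarith

lemma add_rpow_le_two_rpow_mul {e a b : ℝ} (he : 0 ≤ e) (ha : 0 ≤ a) (hb : 0 ≤ b) :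
    (a + b) ^ e ≤ 2 ^ e * (a ^ e + b ^ e) := by
  have hmax : (max a b) ^ e ≤ a ^ e + b ^ e := by
    rcases le_total a b with h | h
    · rw [max_eq_right h]; linarith [Real.rpow_nonneg ha e]
    · rw [max_eq_left h]; linarith [Real.rpow_nonneg hb e]
  calc (a + b) ^ e ≤ (2 * max a b) ^ e :=
        Real.rpow_le_rpow (by positivity) (by linarith [le_max_left a b, le_max_right a b]) he
    _ = 2 ^ e * (max a b) ^ e := Real.mul_rpow (by norm_num) (le_max_of_le_left ha)
    _ ≤ 2 ^ e * (a ^ e + b ^ e) := by gcongr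

lemma abs_rpow_sub_two_mul_sq {q : ℝ} (hq : 2 < q) (x : ℝ) : |x| ^ (q - 2) * x ^ 2 = |x| ^ q := by
  rw [← sq_abs, ← Real.rpow_natCast, ← Real.rpow_add_of_nonneg (abs_nonneg _) (by linarith)
    (by norm_num)]
  norm_num

/-- The constant of the second-order expansion of `t ↦ |t| ^ q`, see `abs_add_rpow_le`. -/
noncomputable def expansionConst (q : ℝ) : ℝ := |q * (q - 1)| * 2 ^ (q - 2)

lemma expansionConst_nonneg (q : ℝ) : 0 ≤ expansionConst q := by
  unfold expansionConst; positivity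

lemma abs_add_rpow_le {q : ℝ} (hq : 2 < q) (x y : ℝ) :
    |x + y| ^ q ≤ |x| ^ q + q * (|x| ^ (q - 2) * x * y) +
      expansionConst q * (|x| ^ (q - 2) * y ^ 2 + |y| ^ q) := by
  have tangent := abs_rpow_add_tangent_le (by linarith : 1 < q) (x + y) x
  have hR : |x + y| ≤ |x| + |y| := abs_add_le x y
  have hR' : |x| ≤ |x| + |y| := le_add_of_nonneg_right (abs_nonneg y)
  have lipschitz : (|x + y| ^ (q - 2) * (x + y) - |x| ^ (q - 2) * x) * y ≤
      (q - 1) * (|x| + |y|) ^ (q - 2) * y ^ 2 := by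
    rcases le_total 0 y with hy | hy
    · have := abs_rpow_mul_self_sub_le (e := q - 2) (by linarith) (by linarith : x ≤ x + y) hR hR'
      nlinarith [mul_le_mul_of_nonneg_right this hy]
    · have := abs_rpow_mul_self_sub_le (e := q - 2) (by linarith) (by linarith : x + y ≤ x) hR' hR
      nlinarith [mul_le_mul_of_nonneg_right this (neg_nonneg.2 hy)]
  have hq0 : 0 ≤ q * (q - 1) := by nlinarith
  have remainder : q * ((q - 1) * (|x| + |y|) ^ (q - 2) * y ^ 2) ≤
      expansionConst q * (|x| ^ (q - 2) * y ^ 2 + |y| ^ q) := by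
    calc q * ((q - 1) * (|x| + |y|) ^ (q - 2) * y ^ 2)
        = q * (q - 1) * (|x| + |y|) ^ (q - 2) * y ^ 2 := by ring
      _ ≤ q * (q - 1) * (2 ^ (q - 2) * (|x| ^ (q - 2) + |y| ^ (q - 2))) * y ^ 2 := by
          gcongr
          exact add_rpow_le_two_rpow_mul (by linarith) (abs_nonneg x) (abs_nonneg y)
      _ = expansionConst q * (|x| ^ (q - 2) * y ^ 2 + |y| ^ (q - 2) * y ^ 2) := by
          rw [expansionConst, abs_of_nonneg hq0]; ring
      _ = _ := by rw [abs_rpow_sub_two_mul_sq hq]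
  nlinarith [mul_le_mul_of_nonneg_left lipschitz (by linarith : 0 ≤ q)]

variable {Ω : Type*} [MeasurableSpace Ω] {μ : Measure Ω}

lemma integrable_abs_rpow_of_le [IsFiniteMeasure μ] {X : Ω → ℝ} {p q : ℝ} (hp : 0 ≤ p)
    (hpq : p ≤ q) (hX : MemLp X (ENNReal.ofReal q) μ) : Integrable (fun ω => |X ω| ^ p) μ := by
  have := (hX.mono_exponent (ENNReal.ofReal_le_ofReal hpq)).integrable_norm_rpow'
  rwa [ENNReal.toReal_ofReal hp] at this

lemma integrable_abs_rpow_mul_self [IsFiniteMeasure μ] {X : Ω → ℝ} {q : ℝ} (hq : 2 < q)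
    (hX : MemLp X (ENNReal.ofReal q) μ) : Integrable (fun ω => |X ω| ^ (q - 2) * X ω) μ := by
  have hdom := integrable_abs_rpow_of_le (p := q - 1) (by linarith) (by linarith) hX
  have hmeas := hX.aestronglyMeasurable.aemeasurable
  refine hdom.mono' (by fun_prop) (.of_forall fun ω => le_of_eq ?_)
  rw [norm_mul, Real.norm_of_nonneg (by positivity), Real.norm_eq_abs,
    ← Real.rpow_add_one' (abs_nonneg _) (by linarith)]
  ring_nf

lemma setIntegral_abs_rpow_le [IsFiniteMeasure μ] {X : Ω → ℝ} {p q : ℝ} (hp : 0 < p) (hpq : p < q)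
    (hX : MemLp X (ENNReal.ofReal q) μ) (F : Set Ω) :
    ∫ ω in F, |X ω| ^ p ∂μ ≤ (∫ ω, |X ω| ^ q ∂μ) ^ (p / q) * μ.real F ^ (1 - p / q) := by
  have hq : 0 < q := hp.trans hpq
  have hconj : (q / p).HolderConjugate ((1 - p / q)⁻¹) := by
    rw [Real.holderConjugate_iff]
    refine ⟨(one_lt_div hp).2 hpq, ?_⟩
    rw [inv_div, inv_inv]
    ring
  have hpow : ∀ ω, (|X ω| ^ p) ^ (q / p) = |X ω| ^ q := fun ω => by
    rw [← Real.rpow_mul (abs_nonneg _), mul_div_cancel₀ _ hp.ne']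
  have hXp : MemLp (fun ω => |X ω| ^ p) (ENNReal.ofReal (q / p)) (μ.restrict F) := by
    have := hX.restrict F |>.norm_rpow_div (ENNReal.ofReal p)
    rwa [ENNReal.toReal_ofReal hp.le, ← ENNReal.ofReal_div_of_pos hp] at this
  have holder := integral_mul_le_Lp_mul_Lq_of_nonneg hconj (μ := μ.restrict F)
    (.of_forall fun ω => by positivity : 0 ≤ᵐ[μ.restrict F] fun ω => |X ω| ^ p)
    (.of_forall fun _ => zero_le_one : 0 ≤ᵐ[μ.restrict F] fun _ => (1 : ℝ)) hXp
    (memLp_const 1)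
  simp only [mul_one, hpow, Real.one_rpow, integral_const, smul_eq_mul, one_div, inv_inv, inv_div,
    measureReal_restrict_apply_univ] at holder
  refine holder.trans ?_
  gcongr
  · exact .of_forall fun ω => by positivity
  · exact integrable_abs_rpow_of_le hq.le le_rfl hX
  · exact Measure.restrict_le_self

lemma integral_abs_add_rpow_le_of_indepFun [IsProbabilityMeasure μ] {X Z : Ω → ℝ} {q : ℝ}
    (hq : 2 < q) (hX : MemLp X (ENNReal.ofReal q) μ) (hZ : MemLp Z (ENNReal.ofReal q) μ)
    (hXZ : IndepFun X Z μ) (hZ0 : ∫ ω, Z ω ∂μ = 0) :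
    ∫ ω, |X ω + Z ω| ^ q ∂μ ≤ ∫ ω, |X ω| ^ q ∂μ + expansionConst q *
      ((∫ ω, |X ω| ^ (q - 2) ∂μ) * ∫ ω, Z ω ^ 2 ∂μ + ∫ ω, |Z ω| ^ q ∂μ) := by
  have hX1 := integrable_abs_rpow_mul_self hq hX
  have hX2 : Integrable (fun ω => |X ω| ^ (q - 2)) μ :=
    integrable_abs_rpow_of_le (by linarith) (by linarith) hX
  have hXq := integrable_abs_rpow_of_le (by linarith) le_rfl hX
  have hZq := integrable_abs_rpow_of_le (by linarith) le_rfl hZ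
  have hZ2 : Integrable (fun ω => Z ω ^ 2) μ := by
    simpa using integrable_abs_rpow_of_le (p := 2) (by norm_num) hq.le hZ
  have hZ1 : Integrable Z μ := hZ.integrable (by simpa using by linarith)
  have hind1 : IndepFun (fun ω => |X ω| ^ (q - 2) * X ω) Z μ :=
    hXZ.comp (φ := fun t : ℝ => |t| ^ (q - 2) * t) (ψ := id) (by fun_prop) (by fun_prop)
  have hind2 : IndepFun (fun ω => |X ω| ^ (q - 2)) (fun ω => Z ω ^ 2) μ :=
    hXZ.comp (φ := fun t : ℝ => |t| ^ (q - 2)) (ψ := fun t => t ^ 2) (by fun_prop) (by fun_prop)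
  have hlin : Integrable (fun ω => |X ω| ^ (q - 2) * X ω * Z ω) μ := hind1.integrable_mul hX1 hZ1
  have hquad : Integrable (fun ω => |X ω| ^ (q - 2) * Z ω ^ 2) μ := hind2.integrable_mul hX2 hZ2
  have hmain : Integrable (fun ω => |X ω| ^ q + q * (|X ω| ^ (q - 2) * X ω * Z ω)) μ :=
    hXq.add (hlin.const_mul q)
  have hrem : Integrable
      (fun ω => expansionConst q * (|X ω| ^ (q - 2) * Z ω ^ 2 + |Z ω| ^ q)) μ :=
    (hquad.add hZq).const_mul (expansionConst q)
  calc ∫ ω, |X ω + Z ω| ^ q ∂μ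
      ≤ ∫ ω, (|X ω| ^ q + q * (|X ω| ^ (q - 2) * X ω * Z ω) +
          expansionConst q * (|X ω| ^ (q - 2) * Z ω ^ 2 + |Z ω| ^ q)) ∂μ :=
        integral_mono (integrable_abs_rpow_of_le (by linarith) le_rfl (hX.add hZ))
          (hmain.add hrem) fun ω => abs_add_rpow_le hq (X ω) (Z ω)
    _ = ∫ ω, |X ω| ^ q ∂μ + q * ∫ ω, |X ω| ^ (q - 2) * X ω * Z ω ∂μ + expansionConst q *
          (∫ ω, |X ω| ^ (q - 2) * Z ω ^ 2 ∂μ + ∫ ω, |Z ω| ^ q ∂μ) := by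
        rw [integral_add hmain hrem, integral_add hXq (hlin.const_mul q), integral_const_mul,
          integral_const_mul, integral_add hquad hZq]
    _ = _ := by
        rw [hind1.integral_fun_mul_eq_mul_integral hX1.aestronglyMeasurable
          hZ1.aestronglyMeasurable, hind2.integral_fun_mul_eq_mul_integral
          hX2.aestronglyMeasurable hZ2.aestronglyMeasurable, hZ0, mul_zero, mul_zero, add_zero]

lemma rpow_add_rpow_sub_one_mul_le {k u v : ℝ} (hk : 1 < k) (hu : 0 ≤ u) (hv : 0 ≤ v) :
    u ^ k + u ^ (k - 1) * v ≤ (u + v) ^ k := by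
  have split : ∀ x : ℝ, 0 ≤ x → x ^ k = x ^ (k - 1) * x := fun x hx => by
    rw [← Real.rpow_add_one' hx (by linarith), sub_add_cancel]
  rw [split u hu, split (u + v) (by positivity), ← mul_add]
  gcongr
  linarith

end Moment

section ErrorModel

variable {Ω : Type*} [MeasurableSpace Ω] {μ : Measure Ω} {n : ℕ} {k σ M : ℝ} {ε : Fin n → Ω → ℝ}

lemma ErrorModel.precomp (h : ErrorModel μ k σ M ε) {r : ℕ} {g : Fin r → Fin n}
    (hg : g.Injective) : ErrorModel μ k σ M (fun l => ε (g l)) where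
  meas _ := h.meas _
  indep := h.indep.precomp hg
  sq_integrable _ := h.sq_integrable _
  mean _ := h.mean _
  var _ := h.var _
  moment_integrable _ := h.moment_integrable _
  moment_le _ := h.moment_le _

lemma ErrorModel.integral_sq (h : ErrorModel μ k σ M ε) (l : Fin n) :
    ∫ ω, ε l ω ^ 2 ∂μ = σ ^ 2 := by
  rw [← h.var l, variance_of_integral_eq_zero (h.meas l).aemeasurable (h.mean l)]

lemma ErrorModel.memLp_sum (h : ErrorModel μ k σ M ε) (a : Fin n → ℝ) :
    MemLp (fun ω => ∑ l, a l * ε l ω) 2 μ :=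
  memLp_finsetSum _ fun l _ => (h.sq_integrable l).const_mul _

lemma ErrorModel.integral_sum_sq (h : ErrorModel μ k σ M ε) (a : Fin n → ℝ) :
    ∫ ω, (∑ l, a l * ε l ω) ^ 2 ∂μ = σ ^ 2 * sqNorm a := by
  have := h.indep.isProbabilityMeasure
  have hmean : ∫ ω, ∑ l, a l * ε l ω ∂μ = 0 := by
    rw [integral_finsetSum _ fun l _ =>
      ((h.sq_integrable l).integrable (by norm_num)).const_mul _]
    simp [integral_const_mul, h.mean]
  rw [← variance_of_integral_eq_zero (h.memLp_sum a).aestronglyMeasurable.aemeasurable hmean]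
  have hsum : (fun ω => ∑ l, a l * ε l ω) = ∑ l, (fun ω => a l * ε l ω) := by
    ext ω; simp
  rw [hsum, IndepFun.variance_sum]
  · simp_rw [variance_const_mul, h.var, sqNorm, Finset.mul_sum, mul_comm]
  · exact fun l _ => (h.sq_integrable l).const_mul _
  · intro i _ j _ hij
    exact (h.indep.indepFun hij).comp (φ := fun x => a i * x) (ψ := fun x => a j * x)
      (by fun_prop) (by fun_prop)

lemma ErrorModel.memLp_rpow (h : ErrorModel μ k σ M ε) (hk : 0 < k) (l : Fin n) :
    MemLp (ε l) (ENNReal.ofReal (2 * k)) μ := by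
  rw [← integrable_norm_rpow_iff (h.meas l).aestronglyMeasurable (by simpa using hk)
    ENNReal.ofReal_ne_top, ENNReal.toReal_ofReal (by linarith)]
  exact h.moment_integrable l

lemma ErrorModel.memLp_rpow_sum (h : ErrorModel μ k σ M ε) (hk : 0 < k) (a : Fin n → ℝ)
    (s : Finset (Fin n)) : MemLp (fun ω => ∑ l ∈ s, a l * ε l ω) (ENNReal.ofReal (2 * k)) μ :=
  memLp_finsetSum s fun l _ => (h.memLp_rpow hk l).const_mul _

lemma ErrorModel.indepFun_sum (h : ErrorModel μ k σ M ε) (a : Fin n → ℝ) {s : Finset (Fin n)}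
    {j : Fin n} (hj : j ∉ s) :
    IndepFun (fun ω => ∑ l ∈ s, a l * ε l ω) (fun ω => a j * ε j ω) μ := by
  have hscaled : iIndepFun (fun l ω => a l * ε l ω) μ :=
    h.indep.comp (fun l x => a l * x) fun l => by fun_prop
  have := hscaled.indepFun_finsetSum_of_notMem (fun l => (h.meas l).const_mul _) hj
  convert this using 1
  ext ω; simp

lemma ErrorModel.integral_abs_sum_rpow_insert_le (h : ErrorModel μ k σ M ε) (hk : 1 < k)
    (a : Fin n → ℝ) {s : Finset (Fin n)} {j : Fin n} (hj : j ∉ s) :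
    ∫ ω, |∑ l ∈ insert j s, a l * ε l ω| ^ (2 * k) ∂μ ≤
      ∫ ω, |∑ l ∈ s, a l * ε l ω| ^ (2 * k) ∂μ + expansionConst (2 * k) *
        ((∫ ω, |∑ l ∈ s, a l * ε l ω| ^ (2 * k) ∂μ) ^ ((k - 1) / k) * (a j ^ 2 * σ ^ 2) +
          M * (a j ^ 2) ^ k) := by
  have := h.indep.isProbabilityMeasure
  have hX := h.memLp_rpow_sum (by linarith) a s
  have step := integral_abs_add_rpow_le_of_indepFun (by linarith) hX
    ((h.memLp_rpow (by linarith) j).const_mul (a j)) (h.indepFun_sum a hj)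
    (by rw [integral_const_mul, h.mean, mul_zero])
  have lyapunov : ∫ ω, |∑ l ∈ s, a l * ε l ω| ^ (2 * k - 2) ∂μ ≤
      (∫ ω, |∑ l ∈ s, a l * ε l ω| ^ (2 * k) ∂μ) ^ ((k - 1) / k) := by
    have := setIntegral_abs_rpow_le (p := 2 * k - 2) (by linarith) (by linarith) hX Set.univ
    rwa [setIntegral_univ, probReal_univ, Real.one_rpow, mul_one,
      show (2 * k - 2) / (2 * k) = (k - 1) / k by field_simp] at this
  have hsq : ∫ ω, (a j * ε j ω) ^ 2 ∂μ = a j ^ 2 * σ ^ 2 := by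
    simp_rw [mul_pow]
    rw [integral_const_mul, h.integral_sq]
  have hmom : ∫ ω, |a j * ε j ω| ^ (2 * k) ∂μ ≤ M * (a j ^ 2) ^ k := by
    have hscale : ∀ ω, |a j * ε j ω| ^ (2 * k) = (a j ^ 2) ^ k * |ε j ω| ^ (2 * k) := fun ω => by
      rw [abs_mul, Real.mul_rpow (abs_nonneg _) (abs_nonneg _), Real.rpow_mul (abs_nonneg (a j)),
        Real.rpow_two, sq_abs]
    simp_rw [hscale]
    rw [integral_const_mul, mul_comm]
    exact mul_le_mul_of_nonneg_right (h.moment_le j) (by positivity)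
  simp only [Finset.sum_insert hj, add_comm (a j * _)]
  rw [hsq] at step
  refine step.trans ?_
  have := expansionConst_nonneg (2 * k)
  gcongr

lemma ErrorModel.integral_abs_sum_rpow_le (h : ErrorModel μ k σ M ε) (hk : 1 < k) {K : ℝ}
    (hK : 0 ≤ K) (hKσ : (2 * expansionConst (2 * k) * σ ^ 2) ^ k ≤ K)
    (hKM : 2 * expansionConst (2 * k) * M ≤ K) (a : Fin n → ℝ) (s : Finset (Fin n)) :
    ∫ ω, |∑ l ∈ s, a l * ε l ω| ^ (2 * k) ∂μ ≤ K * (∑ l ∈ s, a l ^ 2) ^ k := by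
  have hk0 : 0 < k := by linarith
  induction s using Finset.induction_on with
  | empty => simp [Real.zero_rpow (by linarith : 2 * k ≠ 0), Real.zero_rpow hk0.ne']
  | insert j s hj ih =>
    have hins := h.integral_abs_sum_rpow_insert_le hk a hj
    rw [Finset.sum_insert hj, add_comm (a j ^ 2)]
    set c := expansionConst (2 * k)
    have hc : 0 ≤ c := expansionConst_nonneg (2 * k)
    set I := ∫ ω, |∑ l ∈ s, a l * ε l ω| ^ (2 * k) ∂μ
    set u := ∑ l ∈ s, a l ^ 2
    have hI : 0 ≤ I := integral_nonneg fun ω => by positivity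
    have hu : 0 ≤ u := Finset.sum_nonneg fun l _ => sq_nonneg _
    have hIpow : I ^ ((k - 1) / k) ≤ K ^ ((k - 1) / k) * u ^ (k - 1) := by
      calc I ^ ((k - 1) / k) ≤ (K * u ^ k) ^ ((k - 1) / k) :=
            Real.rpow_le_rpow hI ih (div_nonneg (by linarith) hk0.le)
        _ = K ^ ((k - 1) / k) * u ^ (k - 1) := by
            rw [Real.mul_rpow hK (by positivity), ← Real.rpow_mul hu, mul_div_cancel₀ _ hk0.ne']
    have hKpow : K ^ ((k - 1) / k) * (2 * c * σ ^ 2) ≤ K := by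
      have hroot : 2 * c * σ ^ 2 ≤ K ^ k⁻¹ :=
        (Real.le_rpow_inv_iff_of_pos (by positivity) hK hk0).2 hKσ
      calc K ^ ((k - 1) / k) * (2 * c * σ ^ 2) ≤ K ^ ((k - 1) / k) * K ^ k⁻¹ := by gcongr
        _ = K := by
            rw [← Real.rpow_add_of_nonneg hK (div_nonneg (by linarith) hk0.le) (by positivity),
              ← one_div, ← add_div, sub_add_cancel, div_self hk0.ne', Real.rpow_one]
    have hquad : c * (I ^ ((k - 1) / k) * (a j ^ 2 * σ ^ 2)) ≤ K / 2 * (u ^ (k - 1) * a j ^ 2) := by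
      calc c * (I ^ ((k - 1) / k) * (a j ^ 2 * σ ^ 2))
          ≤ c * (K ^ ((k - 1) / k) * u ^ (k - 1) * (a j ^ 2 * σ ^ 2)) := by gcongr
        _ = K ^ ((k - 1) / k) * (2 * c * σ ^ 2) / 2 * (u ^ (k - 1) * a j ^ 2) := by ring
        _ ≤ _ := by gcongr
    have htop : c * M * (a j ^ 2) ^ k ≤ K / 2 * (a j ^ 2) ^ k := by gcongr; linarith
    have hbin := rpow_add_rpow_sub_one_mul_le hk hu (sq_nonneg (a j))
    have hpow := Real.add_rpow_le_rpow_add hu (sq_nonneg (a j)) hk.le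
    nlinarith

/-- The constant of the tail bound `ErrorModel.measureReal_le_abs_sum_le`: its first term serves
`k ≤ 1` (Chebyshev), the others `k > 1` (Markov for the `2k`-th moment). -/
noncomputable def tailConst (k σ M : ℝ) : ℝ :=
  (σ ^ 2) ^ k + (2 * expansionConst (2 * k) * σ ^ 2) ^ k + 2 * expansionConst (2 * k) * |M| + 1

lemma rpow_sq_le_tailConst (k σ M : ℝ) : (σ ^ 2) ^ k ≤ tailConst k σ M := by
  have := expansionConst_nonneg (2 * k)
  have h1 : 0 ≤ (2 * expansionConst (2 * k) * σ ^ 2) ^ k := by positivity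
  have h2 : 0 ≤ 2 * expansionConst (2 * k) * |M| := by positivity
  unfold tailConst
  linarith

lemma tailConst_pos (k σ M : ℝ) : 0 < tailConst k σ M := by
  have := expansionConst_nonneg (2 * k)
  unfold tailConst; positivity

lemma ErrorModel.measureReal_le_abs_sum_le_of_le_one (h : ErrorModel μ k σ M ε) (hk : 0 < k)
    (hk1 : k ≤ 1) (a : Fin n → ℝ) {t : ℝ} (ht : 0 < t) :
    μ.real {ω | t ≤ |∑ l, a l * ε l ω|} ≤ (σ ^ 2) ^ k * (sqNorm a / t ^ 2) ^ k := by
  have := h.indep.isProbabilityMeasure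
  have ha : 0 ≤ sqNorm a := Finset.sum_nonneg fun _ _ => sq_nonneg _
  have chebyshev : μ.real {ω | t ≤ |∑ l, a l * ε l ω|} ≤ σ ^ 2 * (sqNorm a / t ^ 2) := by
    have hmarkov := mul_meas_ge_le_integral_of_nonneg
      (.of_forall fun ω => sq_nonneg (∑ l, a l * ε l ω)) (h.memLp_sum a).integrable_sq (t ^ 2)
    have hset : {ω | t ≤ |∑ l, a l * ε l ω|} = {ω | t ^ 2 ≤ (∑ l, a l * ε l ω) ^ 2} := by
      ext ω
      rw [Set.mem_ofPred_eq, Set.mem_ofPred_eq, ← sq_abs (∑ l, a l * ε l ω),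
        pow_le_pow_iff_left₀ ht.le (abs_nonneg _) two_ne_zero]
    rw [h.integral_sum_sq, ← hset] at hmarkov
    rw [← mul_div_assoc, le_div_iff₀ (by positivity)]
    linarith
  calc μ.real {ω | t ≤ |∑ l, a l * ε l ω|}
      ≤ μ.real {ω | t ≤ |∑ l, a l * ε l ω|} ^ k :=
        Real.self_le_rpow_of_le_one measureReal_nonneg measureReal_le_one hk1
    _ ≤ (σ ^ 2 * (sqNorm a / t ^ 2)) ^ k := Real.rpow_le_rpow measureReal_nonneg chebyshev hk.le
    _ = _ := Real.mul_rpow (by positivity) (by positivity)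

lemma ErrorModel.measureReal_le_abs_sum_le (h : ErrorModel μ k σ M ε) (hk : 0 < k)
    (a : Fin n → ℝ) {t : ℝ} (ht : 0 < t) :
    μ.real {ω | t ≤ |∑ l, a l * ε l ω|} ≤ tailConst k σ M * (sqNorm a / t ^ 2) ^ k := by
  have := h.indep.isProbabilityMeasure
  have ha : 0 ≤ sqNorm a := Finset.sum_nonneg fun _ _ => sq_nonneg _
  rcases le_or_gt k 1 with hk1 | hk1
  · refine (h.measureReal_le_abs_sum_le_of_le_one hk hk1 a ht).trans ?_
    gcongr
    exact rpow_sq_le_tailConst k σ M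
  have hc := expansionConst_nonneg (2 * k)
  have hσ : 0 ≤ (2 * expansionConst (2 * k) * σ ^ 2) ^ k := by positivity
  have hM : 0 ≤ 2 * expansionConst (2 * k) * |M| := by positivity
  have hMle : 2 * expansionConst (2 * k) * M ≤ 2 * expansionConst (2 * k) * |M| := by
    gcongr; exact le_abs_self M
  have hσ' : 0 ≤ (σ ^ 2) ^ k := by positivity
  have moment := h.integral_abs_sum_rpow_le hk1 (tailConst_pos k σ M).le
    (by unfold tailConst; linarith) (by unfold tailConst; linarith) a Finset.univ
  have markov := mul_meas_ge_le_integral_of_nonneg (μ := μ) (.of_forall fun ω => by positivity)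
    (integrable_abs_rpow_of_le (by linarith) le_rfl (h.memLp_rpow_sum hk a Finset.univ))
    (t ^ (2 * k))
  have hset : {ω | t ≤ |∑ l, a l * ε l ω|} =
      {ω | t ^ (2 * k) ≤ |∑ l, a l * ε l ω| ^ (2 * k)} := by
    ext ω
    rw [Set.mem_ofPred_eq, Set.mem_ofPred_eq,
      Real.rpow_le_rpow_iff ht.le (abs_nonneg _) (by linarith)]
  have ht2 : (t ^ 2) ^ k = t ^ (2 * k) := by
    rw [Real.rpow_mul ht.le, Real.rpow_two]
  rw [Real.div_rpow ha (by positivity), ← mul_div_assoc, le_div_iff₀ (by positivity), hset, ht2,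
    mul_comm]
  exact markov.trans moment

end ErrorModel

section Independence

variable {Ω : Type*} [MeasurableSpace Ω] {μ : Measure Ω}

lemma iIndepFun_curry {ι κ E : Type*} [MeasurableSpace E] {X : ι × κ → Ω → E}
    (hX : iIndepFun X μ) (hm : ∀ q, Measurable (X q)) :
    iIndepFun (fun i ω l => X (i, l) ω) μ := by
  have := hX.isProbabilityMeasure
  have hprob : ∀ q, IsProbabilityMeasure (μ.map (X q)) := fun q =>
    Measure.isProbabilityMeasure_map (hm q).aemeasurable
  have hrow : ∀ i, iIndepFun (fun l => X (i, l)) μ := fun i =>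
    hX.precomp (Prod.mk_right_injective i)
  rw [iIndepFun_iff_map_fun_eq_infinitePi_map fun i => measurable_pi_lambda _ fun l => hm _]
  simp_rw [fun i => (hrow i).map_fun_eq_infinitePi_map fun _ => hm _]
  rw [← Measure.infinitePi_map_curry fun i l => μ.map (X (i, l)),
    ← hX.map_fun_eq_infinitePi_map hm,
    Measure.map_map (by fun_prop) (measurable_pi_lambda _ hm)]
  rfl

lemma iIndepFun_integrable_prod {ι : Type*} [Fintype ι] {X : ι → Ω → ℝ} (hX : iIndepFun X μ)
    (hint : ∀ i, Integrable (X i) μ) : Integrable (fun ω => ∏ i, X i ω) μ := by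
  have := hX.isProbabilityMeasure
  have hmeas : AEMeasurable (fun ω i => X i ω) μ :=
    aemeasurable_pi_lambda _ fun i => (hint i).aemeasurable
  have : ∀ i, IsProbabilityMeasure (μ.map (X i)) := fun i =>
    Measure.isProbabilityMeasure_map (hint i).aemeasurable
  have hid : ∀ i, Integrable (fun x : ℝ => x) (μ.map (X i)) := fun i =>
    (integrable_map_measure aestronglyMeasurable_id (hint i).aemeasurable).2 (hint i)
  have hpi := Integrable.fintype_prod hid
  rw [← hX.map_fun_eq_pi_map fun i => (hint i).aemeasurable] at hpi
  exact hpi.comp_aemeasurable hmeas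

end Independence

section Majority

variable {Ω ι E : Type*}

open Classical in
/-- Tilting factor of an event, for a Chernoff bound: the product of `tilt s (F i)` over `i`
dominates the indicator of a majority of the events `F i` for every `s ∈ (0, 1]`. -/
noncomputable def tilt (s : ℝ) (F : Set E) (x : E) : ℝ := if x ∈ F then s⁻¹ else s

lemma tilt_nonneg {s : ℝ} (hs : 0 ≤ s) (F : Set E) (x : E) : 0 ≤ tilt s F x := by
  unfold tilt
  split_ifs <;> positivity

lemma mul_tilt_eq (g : E → ℝ) (s : ℝ) (F : Set E) :
    (fun x => g x * tilt s F x) = fun x => s⁻¹ * F.indicator g x + s * Fᶜ.indicator g x := by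
  ext x
  by_cases hx : x ∈ F <;> simp [tilt, hx, mul_comm]

variable [Fintype ι]

open Classical in
/-- The event that at least half of the events `F i` occur. -/
def majority (F : ι → Set Ω) : Set Ω :=
  {ω | Fintype.card ι ≤ 2 * (Finset.univ.filter fun i => ω ∈ F i).card}

lemma one_le_prod_tilt {s : ℝ} (hs : 0 < s) (hs1 : s ≤ 1) {F : ι → Set Ω} {ω : Ω}
    (hω : ω ∈ majority F) : 1 ≤ ∏ i, tilt s (F i) ω := by
  classical
  have hcard := Finset.card_filter_add_card_filter_not (s := Finset.univ) fun i => ω ∈ F i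
  rw [Finset.card_univ] at hcard
  have hle : (Finset.univ.filter fun i => ω ∉ F i).card ≤
      (Finset.univ.filter fun i => ω ∈ F i).card := by
    simp only [majority, Set.mem_ofPred_eq] at hω
    convert_to _ ≤ _ at hω
    lia
  simp only [tilt, Finset.prod_ite, Finset.prod_const]
  rw [inv_pow, ← div_eq_inv_mul, one_le_div (by positivity)]
  exact pow_le_pow_of_le_one hs.le hs1 hle

lemma lt_two_mul_card_of_notMem_majority {F : ι → Set Ω} {ω : Ω} (hω : ω ∉ majority F)
    {P : ι → Prop} [DecidablePred P] (hP : ∀ i, ω ∉ F i → P i) :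
    Fintype.card ι < 2 * (Finset.univ.filter P).card := by
  classical
  have hfail : 2 * (Finset.univ.filter fun i => ω ∈ F i).card < Fintype.card ι := by
    rw [majority, Set.mem_ofPred_eq, not_le] at hω
    convert hω
  have hsuccess : (Finset.univ.filter fun i => ω ∉ F i).card ≤ (Finset.univ.filter P).card :=
    Finset.card_le_card (Finset.monotone_filter_right _ fun i _ => hP i)
  have hcard := Finset.card_filter_add_card_filter_not (s := Finset.univ) fun i => ω ∈ F i
  rw [Finset.card_univ] at hcard
  omega

variable [MeasurableSpace Ω] {μ : Measure Ω} [MeasurableSpace E]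

lemma measurableSet_majority {F : ι → Set Ω} (hF : ∀ i, MeasurableSet (F i)) :
    MeasurableSet (majority F) := by
  classical
  refine measurableSet_le measurable_const (Measurable.const_mul ?_ 2)
  simp_rw [Finset.card_filter]
  exact Finset.measurable_fun_sum _ fun i _ =>
    Measurable.ite (hF i) measurable_const measurable_const

lemma integrable_mul_tilt {g : Ω → ℝ} (hg : Integrable g μ) (s : ℝ) {F : Set Ω}
    (hF : MeasurableSet F) : Integrable (fun ω => g ω * tilt s F ω) μ := by
  rw [mul_tilt_eq]
  exact ((hg.indicator hF).const_mul _).add ((hg.indicator hF.compl).const_mul _)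

lemma integral_mul_tilt_le {g : Ω → ℝ} (hg : Integrable g μ) (hg0 : 0 ≤ g) {s v : ℝ} (hs : 0 < s)
    {F : Set Ω} (hF : MeasurableSet F) (hFv : ∫ ω in F, g ω ∂μ ≤ s ^ 2 * v)
    (hv : ∫ ω, g ω ∂μ ≤ v) : ∫ ω, g ω * tilt s F ω ∂μ ≤ 2 * s * v := by
  have hcompl : ∫ ω in Fᶜ, g ω ∂μ ≤ v :=
    (setIntegral_le_integral hg (.of_forall hg0)).trans hv
  rw [mul_tilt_eq, integral_add ((hg.indicator hF).const_mul _)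
    ((hg.indicator hF.compl).const_mul _), integral_const_mul, integral_const_mul,
    integral_indicator hF, integral_indicator hF.compl]
  calc s⁻¹ * ∫ ω in F, g ω ∂μ + s * ∫ ω in Fᶜ, g ω ∂μ ≤ s⁻¹ * (s ^ 2 * v) + s * v := by gcongr
    _ = 2 * s * v := by field_simp; ring

lemma setIntegral_majority_prod_le {W : ι → Ω → E} (hW : iIndepFun W μ)
    (hWm : ∀ i, Measurable (W i)) {A : ι → Set E} (hA : ∀ i, MeasurableSet (A i))
    {g : ι → E → ℝ} (hgm : ∀ i, Measurable (g i)) (hg0 : ∀ i, 0 ≤ g i)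
    (hg : ∀ i, Integrable (fun ω => g i (W i ω)) μ) {s : ℝ} (hs : 0 < s) (hs1 : s ≤ 1) {v : ι → ℝ}
    (hFv : ∀ i, ∫ ω in W i ⁻¹' A i, g i (W i ω) ∂μ ≤ s ^ 2 * v i)
    (hv : ∀ i, ∫ ω, g i (W i ω) ∂μ ≤ v i) :
    ∫ ω in majority fun i => W i ⁻¹' A i, ∏ i, g i (W i ω) ∂μ ≤
      (2 * s) ^ Fintype.card ι * ∏ i, v i := by
  have hF : ∀ i, MeasurableSet (W i ⁻¹' A i) := fun i => hWm i (hA i)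
  have htilt : ∀ i, Measurable fun x => g i x * tilt s (A i) x := fun i =>
    (hgm i).mul (Measurable.ite (hA i) measurable_const measurable_const)
  have hind : iIndepFun (fun i ω => g i (W i ω) * tilt s (W i ⁻¹' A i) ω) μ :=
    hW.comp (fun i x => g i x * tilt s (A i) x) htilt
  have hint : ∀ i, Integrable (fun ω => g i (W i ω) * tilt s (W i ⁻¹' A i) ω) μ := fun i =>
    integrable_mul_tilt (hg i) s (hF i)
  have hnonneg : ∀ i ω, 0 ≤ g i (W i ω) * tilt s (W i ⁻¹' A i) ω := fun i ω =>
    mul_nonneg (hg0 i _) (tilt_nonneg hs.le _ ω)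
  calc ∫ ω in majority fun i => W i ⁻¹' A i, ∏ i, g i (W i ω) ∂μ
      = ∫ ω, (majority fun i => W i ⁻¹' A i).indicator (fun ω => ∏ i, g i (W i ω)) ω ∂μ :=
        (integral_indicator (measurableSet_majority hF)).symm
    _ ≤ ∫ ω, ∏ i, g i (W i ω) * tilt s (W i ⁻¹' A i) ω ∂μ := by
        refine integral_mono_of_nonneg (.of_forall fun ω => ?_)
          (iIndepFun_integrable_prod hind hint) (.of_forall fun ω => ?_)
        · exact Set.indicator_nonneg (fun ω _ => Finset.prod_nonneg fun i _ => hg0 i (W i ω)) ω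
        · refine Set.indicator_apply_le' (fun hω => ?_)
            fun _ => Finset.prod_nonneg fun i _ => hnonneg i ω
          beta_reduce
          rw [Finset.prod_mul_distrib]
          exact le_mul_of_one_le_right (Finset.prod_nonneg fun i _ => hg0 i _)
            (one_le_prod_tilt hs hs1 hω)
    _ = ∏ i, ∫ ω, g i (W i ω) * tilt s (W i ⁻¹' A i) ω ∂μ :=
        hind.integral_fun_prod_eq_prod_integral fun i => (hint i).aestronglyMeasurable
    _ ≤ ∏ i, 2 * s * v i := Finset.prod_le_prod
        (fun i _ => integral_nonneg (hnonneg i))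
        fun i _ => integral_mul_tilt_le (hg i) (fun ω => hg0 i _) hs (hF i) (hFv i) (hv i)
    _ = (2 * s) ^ Fintype.card ι * ∏ i, v i := by
        rw [Finset.prod_mul_distrib, Finset.prod_const, Finset.card_univ]

lemma measureReal_majority_le {W : ι → Ω → E} (hW : iIndepFun W μ)
    (hWm : ∀ i, Measurable (W i)) {A : ι → Set E} (hA : ∀ i, MeasurableSet (A i)) {s : ℝ}
    (hs : 0 < s) (hs1 : s ≤ 1) (hP : ∀ i, μ.real (W i ⁻¹' A i) ≤ s ^ 2) :
    μ.real (majority fun i => W i ⁻¹' A i) ≤ (2 * s) ^ Fintype.card ι := by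
  have := hW.isProbabilityMeasure
  simpa using setIntegral_majority_prod_le hW hWm hA (g := fun _ _ => 1)
    (fun _ => measurable_const) (fun _ _ => zero_le_one) (fun _ => integrable_const 1) hs hs1
    (v := fun _ => 1) (by simpa using hP) (by simp)

lemma setIntegral_majority_le {W : ι → Ω → E} (hW : iIndepFun W μ)
    (hWm : ∀ i, Measurable (W i)) {A : ι → Set E} (hA : ∀ i, MeasurableSet (A i)) {s : ℝ}
    (hs : 0 < s) (hs1 : s ≤ 1) (hP : ∀ i, μ.real (W i ⁻¹' A i) ≤ s ^ 2) {g : E → ℝ}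
    (hgm : Measurable g) (hg0 : 0 ≤ g) (i : ι) (hg : Integrable (fun ω => g (W i ω)) μ) {v : ℝ}
    (hFv : ∫ ω in W i ⁻¹' A i, g (W i ω) ∂μ ≤ s ^ 2 * v) (hv : ∫ ω, g (W i ω) ∂μ ≤ v) :
    ∫ ω in majority fun i => W i ⁻¹' A i, g (W i ω) ∂μ ≤ (2 * s) ^ Fintype.card ι * v := by
  classical
  have := hW.isProbabilityMeasure
  have key := setIntegral_majority_prod_le hW hWm hA (g := fun j => if j = i then g else 1)
    (fun j => ?_) (fun j => ?_) (fun j => ?_) hs hs1 (v := fun j => if j = i then v else 1)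
    (fun j => ?_) (fun j => ?_)
  · simpa [ite_apply] using key
  all_goals rcases eq_or_ne j i with rfl | hj
  · simpa using hgm
  · simpa [hj] using measurable_one
  · simpa using hg0
  · simp [hj]
  · simpa using hg
  · simp [hj]
  · simpa using hFv
  · simpa [hj] using hP j
  · simpa using hv
  · simp [hj]

end Majority

lemma IsMedianModel.eq_of_lt_two_mul_card {p m : ℕ} {γ : Fin m → Finset (Fin p)}
    {G S : Finset (Fin p)} (h : IsMedianModel γ G)
    (hS : m < 2 * (Finset.univ.filter fun i => γ i = S).card) : G = S := by
  by_contra hne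
  have hd : 0 < (symmDiff G S).card := by
    rw [Finset.card_pos, Finset.nonempty_iff_ne_empty]
    simpa [symmDiff_eq_bot] using hne
  have hcompare : ∀ i, (symmDiff S (γ i)).card + (if γ i = S then 2 * (symmDiff G S).card else 0) ≤
      (symmDiff G (γ i)).card + (symmDiff G S).card := by
    intro i
    split_ifs with hi
    · simp [hi, two_mul]
    · have := (Finset.card_le_card (symmDiff_triangle S G (γ i))).trans (Finset.card_union_le _ _)
      rw [symmDiff_comm S G] at this
      lia
  have hsum := Finset.sum_le_sum fun i (_ : i ∈ Finset.univ) => hcompare i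
  simp only [Finset.sum_add_distrib, ← Finset.sum_filter, Finset.sum_const, Finset.card_univ,
    Fintype.card_fin, smul_eq_mul] at hsum
  have hmin := h S
  have hlt := Nat.mul_lt_mul_of_pos_right hS hd
  lia

section SqNorm

open Matrix

variable {κ : Type*} [Fintype κ]

lemma sqNorm_eq_dotProduct (v : κ → ℝ) : sqNorm v = v ⬝ᵥ v := by
  simp [sqNorm, dotProduct, pow_two]

lemma sqNorm_nonneg (v : κ → ℝ) : 0 ≤ sqNorm v :=
  Finset.sum_nonneg fun _ _ => sq_nonneg _

lemma sq_le_sqNorm (v : κ → ℝ) (j : κ) : v j ^ 2 ≤ sqNorm v :=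
  Finset.single_le_sum (f := fun j => v j ^ 2) (fun _ _ => sq_nonneg _) (Finset.mem_univ j)

lemma dotProduct_sq_le (v w : κ → ℝ) : (v ⬝ᵥ w) ^ 2 ≤ sqNorm v * sqNorm w :=
  Finset.sum_mul_sq_le_sq_mul_sq _ _ _

lemma sqNorm_eq_zero {v : κ → ℝ} : sqNorm v = 0 ↔ v = 0 := by
  rw [sqNorm_eq_dotProduct, dotProduct_self_eq_zero]

lemma sqNorm_eq_norm_sq (v : κ → ℝ) : sqNorm v = ‖WithLp.toLp 2 v‖ ^ 2 := by
  simp [sqNorm, EuclideanSpace.norm_sq_eq]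

lemma dotProduct_eq_inner (v w : κ → ℝ) :
    v ⬝ᵥ w = inner ℝ (WithLp.toLp 2 v) (WithLp.toLp 2 w) := by
  simp [PiLp.inner_apply, dotProduct, mul_comm]

end SqNorm

section LeastSquares

open Matrix

variable {ι κ : Type*} [Fintype ι] [Fintype κ] {A : Matrix ι κ ℝ} {c : ℝ}

/-- The design `A` is bounded below: `c ‖v‖² ≤ ‖A v‖²`, that is, `c` is a lower bound for the
eigenvalues of `Aᵀ A`. This is the form in which the eigenvalue conditions are used. -/
def BoundedBelow (A : Matrix ι κ ℝ) (c : ℝ) : Prop :=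
  ∀ v, c * sqNorm v ≤ sqNorm (A *ᵥ v)

lemma dotProduct_transpose_mulVec (A : Matrix ι κ ℝ) (v : κ → ℝ) (w : ι → ℝ) :
    v ⬝ᵥ (Aᵀ *ᵥ w) = (A *ᵥ v) ⬝ᵥ w := by
  rw [dotProduct_mulVec, vecMul_transpose]

lemma dotProduct_transpose_mul_self_mulVec (A : Matrix ι κ ℝ) (v w : κ → ℝ) :
    v ⬝ᵥ ((Aᵀ * A) *ᵥ w) = (A *ᵥ v) ⬝ᵥ (A *ᵥ w) := by
  rw [← mulVec_mulVec, dotProduct_transpose_mulVec]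

lemma BoundedBelow.eq_zero (h : BoundedBelow A c) (hc : 0 < c) {v : κ → ℝ}
    (hv : sqNorm (A *ᵥ v) = 0) : v = 0 := by
  refine sqNorm_eq_zero.1 (le_antisymm ?_ (sqNorm_nonneg v))
  exact nonpos_of_mul_nonpos_right (hv ▸ h v) hc

variable [DecidableEq κ]

lemma MinEigenvalueGE.mul_sqNorm_le {B : Matrix κ κ ℝ} (hB : B.IsHermitian)
    (h : MinEigenvalueGE B c) (v : κ → ℝ) : c * sqNorm v ≤ v ⬝ᵥ (B *ᵥ v) := by
  have hpsd : (B - algebraMap ℝ _ c).PosSemidef := by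
    rw [posSemidef_iff_isHermitian_and_spectrum_nonneg]
    refine ⟨hB.sub ?_, fun t ht => ?_⟩
    · rw [Matrix.IsHermitian, algebraMap_eq_diagonal, diagonal_conjTranspose]
      congr 1
    · rw [← spectrum.sub_singleton_eq] at ht
      obtain ⟨t', ht', _, rfl, rfl⟩ := ht
      exact sub_nonneg.2 (h t' ht')
  have hv := hpsd.dotProduct_mulVec_nonneg v
  rwa [star_trivial, sub_mulVec, dotProduct_sub, Algebra.algebraMap_eq_smul_one, smul_mulVec,
    one_mulVec, dotProduct_smul, ← sqNorm_eq_dotProduct, smul_eq_mul, sub_nonneg] at hv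

lemma MinEigenvalueGE.boundedBelow {s : ℝ} (hs : 0 < s)
    (h : MinEigenvalueGE ((1 / s) • (Aᵀ * A)) c) : BoundedBelow A (s * c) := by
  have hH : ((1 / s) • (Aᵀ * A)).IsHermitian := by
    simp [Matrix.IsHermitian, conjTranspose_eq_transpose_of_trivial, transpose_mul]
  intro v
  have hv := h.mul_sqNorm_le hH v
  rw [smul_mulVec, dotProduct_smul, dotProduct_transpose_mul_self_mulVec, ← sqNorm_eq_dotProduct,
    smul_eq_mul, one_div, inv_mul_eq_div, le_div_iff₀ hs] at hv
  linarith

lemma BoundedBelow.isUnit_det (h : BoundedBelow A c) (hc : 0 < c) : IsUnit (Aᵀ * A).det := by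
  rw [← isUnit_iff_isUnit_det, ← mulVec_injective_iff_isUnit]
  intro v w hvw
  refine sub_eq_zero.1 (h.eq_zero hc ?_)
  rw [sqNorm_eq_dotProduct, ← dotProduct_transpose_mul_self_mulVec, mulVec_sub,
    sub_eq_zero.2 hvw, dotProduct_zero]

lemma BoundedBelow.mulVec_inv_mulVec (h : BoundedBelow A c) (hc : 0 < c) (v : κ → ℝ) :
    (Aᵀ * A) *ᵥ ((Aᵀ * A)⁻¹ *ᵥ v) = v := by
  rw [mulVec_mulVec, mul_nonsing_inv _ (h.isUnit_det hc), one_mulVec]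

lemma BoundedBelow.inv_mulVec_mulVec (h : BoundedBelow A c) (hc : 0 < c) (v : κ → ℝ) :
    (Aᵀ * A)⁻¹ *ᵥ ((Aᵀ * A) *ᵥ v) = v := by
  rw [mulVec_mulVec, nonsing_inv_mul _ (h.isUnit_det hc), one_mulVec]

lemma BoundedBelow.sq_mul_sqNorm_inv_mulVec_le (h : BoundedBelow A c) (hc : 0 < c) (z : κ → ℝ) :
    c ^ 2 * sqNorm ((Aᵀ * A)⁻¹ *ᵥ z) ≤ sqNorm z := by
  set a := (Aᵀ * A)⁻¹ *ᵥ z with ha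
  have hdot : c * sqNorm a ≤ a ⬝ᵥ z := by
    have := h a
    rwa [sqNorm_eq_dotProduct (A *ᵥ a), ← dotProduct_transpose_mul_self_mulVec, ha,
      h.mulVec_inv_mulVec hc, ← ha] at this
  rcases (sqNorm_nonneg a).eq_or_lt with h0 | h0
  · rw [← h0, mul_zero]
    exact sqNorm_nonneg z
  · have hsq : (c * sqNorm a) ^ 2 ≤ sqNorm a * sqNorm z :=
      (pow_le_pow_left₀ (by positivity) hdot 2).trans (dotProduct_sq_le a z)
    exact le_of_mul_le_mul_left (by linarith [hsq]) h0

/-- The least squares coefficients of the response `w` in the design `A`. -/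
noncomputable def lsCoef (A : Matrix ι κ ℝ) (w : ι → ℝ) : κ → ℝ :=
  (Aᵀ * A)⁻¹ *ᵥ (Aᵀ *ᵥ w)

/-- The weights with which the responses enter the least squares coefficient `j`. -/
noncomputable def lsWeight (A : Matrix ι κ ℝ) (j : κ) : ι → ℝ :=
  ((Aᵀ * A)⁻¹ * Aᵀ) j

/-- The least squares residual: the component of `w` orthogonal to the columns of `A`. -/
noncomputable def lsResid (A : Matrix ι κ ℝ) (w : ι → ℝ) : ι → ℝ :=
  w - A *ᵥ lsCoef A w

lemma lsCoef_apply (A : Matrix ι κ ℝ) (w : ι → ℝ) (j : κ) :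
    lsCoef A w j = lsWeight A j ⬝ᵥ w := by
  rw [lsCoef, mulVec_mulVec]
  rfl

lemma BoundedBelow.lsCoef_mulVec_add (h : BoundedBelow A c) (hc : 0 < c) (v : κ → ℝ)
    (w : ι → ℝ) : lsCoef A (A *ᵥ v + w) = v + lsCoef A w := by
  rw [lsCoef, mulVec_add, mulVec_add, mulVec_mulVec v, h.inv_mulVec_mulVec hc, lsCoef]

lemma BoundedBelow.mulVec_dotProduct_mulVec_lsCoef (h : BoundedBelow A c) (hc : 0 < c)
    (v : κ → ℝ) (w : ι → ℝ) : (A *ᵥ v) ⬝ᵥ (A *ᵥ lsCoef A w) = (A *ᵥ v) ⬝ᵥ w := by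
  rw [← dotProduct_transpose_mul_self_mulVec, lsCoef, h.mulVec_inv_mulVec hc,
    dotProduct_transpose_mulVec]

lemma BoundedBelow.transpose_mulVec_lsResid (h : BoundedBelow A c) (hc : 0 < c) (w : ι → ℝ) :
    Aᵀ *ᵥ lsResid A w = 0 := by
  rw [lsResid, mulVec_sub, mulVec_mulVec, lsCoef, h.mulVec_inv_mulVec hc, sub_self]

lemma BoundedBelow.lsResid_dotProduct (h : BoundedBelow A c) (hc : 0 < c) (x w : ι → ℝ) :
    lsResid A x ⬝ᵥ w = x ⬝ᵥ lsResid A w := by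
  rw [lsResid, lsResid, sub_dotProduct, dotProduct_sub, dotProduct_comm x (A *ᵥ _),
    ← h.mulVec_dotProduct_mulVec_lsCoef hc, ← h.mulVec_dotProduct_mulVec_lsCoef hc (lsCoef A w),
    dotProduct_comm (A *ᵥ lsCoef A w)]

lemma BoundedBelow.sqNorm_lsResid_le (h : BoundedBelow A c) (hc : 0 < c) (x : ι → ℝ) :
    sqNorm (lsResid A x) ≤ sqNorm x := by
  have hpyth : sqNorm (lsResid A x) = sqNorm x - sqNorm (A *ᵥ lsCoef A x) := by
    simp only [lsResid, sqNorm_eq_dotProduct, sub_dotProduct, dotProduct_sub]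
    rw [dotProduct_comm x (A *ᵥ lsCoef A x), h.mulVec_dotProduct_mulVec_lsCoef hc]
    ring
  linarith [sqNorm_nonneg (A *ᵥ lsCoef A x)]

lemma BoundedBelow.mul_sqNorm_lsCoef_le (h : BoundedBelow A c) (hc : 0 < c) {w : ι → ℝ} {Z : ℝ}
    (hZ : ∀ v, ((A *ᵥ v) ⬝ᵥ w) ^ 2 ≤ sqNorm (A *ᵥ v) * Z) (hZ0 : 0 ≤ Z) :
    c * sqNorm (lsCoef A w) ≤ Z := by
  refine (h _).trans ?_
  have hsq := hZ (lsCoef A w)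
  rw [← h.mulVec_dotProduct_mulVec_lsCoef hc, ← sqNorm_eq_dotProduct, pow_two] at hsq
  rcases (sqNorm_nonneg (A *ᵥ lsCoef A w)).eq_or_lt with h0 | h0
  · rwa [← h0]
  · exact le_of_mul_le_mul_left hsq h0

lemma BoundedBelow.sqNorm_lsWeight_le (h : BoundedBelow A c) (hc : 0 < c) (j : κ) :
    sqNorm (lsWeight A j) ≤ 1 / c := by
  set W := sqNorm (lsWeight A j) with hW
  have hcoef : c * sqNorm (lsCoef A (lsWeight A j)) ≤ W :=
    h.mul_sqNorm_lsCoef_le hc (fun _ => dotProduct_sq_le _ _) (sqNorm_nonneg _)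
  have hentry : W ^ 2 ≤ sqNorm (lsCoef A (lsWeight A j)) := by
    refine le_trans (le_of_eq ?_) (sq_le_sqNorm _ j)
    rw [lsCoef_apply, ← sqNorm_eq_dotProduct]
  rcases (sqNorm_nonneg (lsWeight A j)).eq_or_lt with h0 | h0
  · rw [hW, ← h0]
    positivity
  · rw [le_div_iff₀ hc]
    refine le_of_mul_le_mul_left ?_ h0
    nlinarith [mul_le_mul_of_nonneg_left hentry hc.le]

end LeastSquares

section FittedEnergy

open Matrix

variable {ι κ : Type*}

/-- The span of the columns of `A`, in Euclidean space. -/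
def colSpace (A : Matrix ι κ ℝ) : Submodule ℝ (EuclideanSpace ℝ ι) :=
  Submodule.span ℝ (Set.range fun j => WithLp.toLp 2 (A.col j))

lemma toLp_mulVec_mem_colSpace [Fintype κ] (A : Matrix ι κ ℝ) (b : κ → ℝ) :
    WithLp.toLp 2 (A *ᵥ b) ∈ colSpace A := by
  have hsum : WithLp.toLp 2 (A *ᵥ b) = ∑ j, b j • WithLp.toLp 2 (A.col j) := by
    ext l
    simp [mulVec, dotProduct, mul_comm]
  rw [hsum]
  exact Submodule.sum_mem _ fun j _ => Submodule.smul_mem _ _ (Submodule.subset_span ⟨j, rfl⟩)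

lemma finrank_colSpace_le [Fintype κ] (A : Matrix ι κ ℝ) :
    Module.finrank ℝ (colSpace A) ≤ Fintype.card κ :=
  finrank_range_le_card _

variable [Fintype ι]

/-- The energy `‖P w‖²` of the orthogonal projection of `w` to the column space of `A`: the part
of the noise that regression on any of the columns can pick up. -/
noncomputable def fittedEnergy (A : Matrix ι κ ℝ) (w : ι → ℝ) : ℝ :=
  ‖(colSpace A).orthogonalProjectionOnto (WithLp.toLp 2 w)‖ ^ 2

lemma fittedEnergy_nonneg (A : Matrix ι κ ℝ) (w : ι → ℝ) : 0 ≤ fittedEnergy A w :=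
  sq_nonneg _

lemma fittedEnergy_le_sqNorm (A : Matrix ι κ ℝ) (w : ι → ℝ) : fittedEnergy A w ≤ sqNorm w := by
  rw [sqNorm_eq_norm_sq, fittedEnergy]
  gcongr
  exact Submodule.norm_orthogonalProjectionOnto_apply_le _ _

lemma fittedEnergy_add_le (A : Matrix ι κ ℝ) (v w : ι → ℝ) :
    fittedEnergy A (v + w) ≤ 2 * fittedEnergy A v + 2 * fittedEnergy A w := by
  simp only [fittedEnergy, WithLp.toLp_add, map_add]
  set x := (colSpace A).orthogonalProjectionOnto (WithLp.toLp 2 v)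
  set y := (colSpace A).orthogonalProjectionOnto (WithLp.toLp 2 w)
  nlinarith [parallelogram_law_with_norm ℝ x y, mul_self_nonneg ‖x - y‖]

lemma mulVec_dotProduct_sq_le [Fintype κ] (A : Matrix ι κ ℝ) (b : κ → ℝ) (w : ι → ℝ) :
    ((A *ᵥ b) ⬝ᵥ w) ^ 2 ≤ sqNorm (A *ᵥ b) * fittedEnergy A w := by
  set x : colSpace A := ⟨WithLp.toLp 2 (A *ᵥ b), toLp_mulVec_mem_colSpace A b⟩
  have hx : (A *ᵥ b) ⬝ᵥ w =
      inner ℝ x ((colSpace A).orthogonalProjectionOnto (WithLp.toLp 2 w)) := by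
    rw [dotProduct_eq_inner, Submodule.inner_orthogonalProjectionOnto_eq_of_mem_left]
  rw [hx, sqNorm_eq_norm_sq, fittedEnergy, ← mul_pow, sq_le_sq, abs_of_nonneg
    (mul_nonneg (norm_nonneg _) (norm_nonneg _))]
  exact abs_real_inner_le_norm _ _

@[fun_prop]
lemma measurable_fittedEnergy (A : Matrix ι κ ℝ) : Measurable (fittedEnergy A) := by
  have : Continuous (fittedEnergy A) := by
    unfold fittedEnergy
    fun_prop
  exact this.measurable

end FittedEnergy

section NoiseEnergy

open Matrix

variable {Ω κ : Type*} [MeasurableSpace Ω] {μ : Measure Ω} {n : ℕ} {k σ M : ℝ}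
  {ε : Fin n → Ω → ℝ}

lemma ErrorModel.measurable_noise (h : ErrorModel μ k σ M ε) : Measurable fun ω l => ε l ω :=
  measurable_pi_lambda _ h.meas

lemma ErrorModel.integrable_sqNorm (h : ErrorModel μ k σ M ε) :
    Integrable (fun ω => sqNorm fun l => ε l ω) μ :=
  integrable_finsetSum _ fun l _ => (h.sq_integrable l).integrable_sq

lemma ErrorModel.integral_sqNorm [IsProbabilityMeasure μ] (h : ErrorModel μ k σ M ε) :
    ∫ ω, sqNorm (fun l => ε l ω) ∂μ = n * σ ^ 2 := by
  simp only [sqNorm]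
  rw [integral_finsetSum _ fun l _ => (h.sq_integrable l).integrable_sq]
  simp [h.integral_sq]

lemma ErrorModel.integrable_fittedEnergy (h : ErrorModel μ k σ M ε) (A : Matrix (Fin n) κ ℝ) :
    Integrable (fun ω => fittedEnergy A fun l => ε l ω) μ := by
  refine h.integrable_sqNorm.mono'
    ((measurable_fittedEnergy A).comp h.measurable_noise).aestronglyMeasurable
    (Filter.Eventually.of_forall fun ω => ?_)
  rw [Real.norm_of_nonneg (fittedEnergy_nonneg _ _)]
  exact fittedEnergy_le_sqNorm _ _

lemma ErrorModel.integral_fittedEnergy_le [IsProbabilityMeasure μ] (h : ErrorModel μ k σ M ε)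
    (A : Matrix (Fin n) κ ℝ) : ∫ ω, fittedEnergy A (fun l => ε l ω) ∂μ ≤ n * σ ^ 2 :=
  h.integral_sqNorm ▸ integral_mono (h.integrable_fittedEnergy A) h.integrable_sqNorm
    fun _ => fittedEnergy_le_sqNorm _ _

lemma fittedEnergy_eq_sum {ι : Type*} [Fintype ι] (A : Matrix ι κ ℝ) (w : ι → ℝ) :
    fittedEnergy A w =
      ∑ a, ((stdOrthonormalBasis ℝ (colSpace A) a : EuclideanSpace ℝ ι).ofLp ⬝ᵥ w) ^ 2 := by
  rw [fittedEnergy, ← (stdOrthonormalBasis ℝ (colSpace A)).sum_sq_norm_inner_right]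
  refine Finset.sum_congr rfl fun a _ => ?_
  rw [Real.norm_eq_abs, sq_abs, dotProduct_eq_inner,
    Submodule.inner_orthogonalProjectionOnto_eq_of_mem_left, WithLp.toLp_ofLp]

lemma ErrorModel.integral_fittedEnergy_le_card [IsProbabilityMeasure μ] [Fintype κ]
    (h : ErrorModel μ k σ M ε) (A : Matrix (Fin n) κ ℝ) :
    ∫ ω, fittedEnergy A (fun l => ε l ω) ∂μ ≤ Fintype.card κ * σ ^ 2 := by
  set B := stdOrthonormalBasis ℝ (colSpace A)
  have hunit : ∀ a, sqNorm (B a : EuclideanSpace ℝ (Fin n)).ofLp = 1 := fun a => by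
    rw [sqNorm_eq_norm_sq, WithLp.toLp_ofLp, Submodule.norm_coe, B.orthonormal.1 a, one_pow]
  calc ∫ ω, fittedEnergy A (fun l => ε l ω) ∂μ
      = ∑ a, ∫ ω, (∑ l, (B a : EuclideanSpace ℝ (Fin n)) l * ε l ω) ^ 2 ∂μ := by
        simp only [fittedEnergy_eq_sum]
        exact integral_finsetSum _ fun a _ => (h.memLp_sum _).integrable_sq
    _ = Module.finrank ℝ (colSpace A) * σ ^ 2 := by
        simp [h.integral_sum_sq, hunit]
    _ ≤ Fintype.card κ * σ ^ 2 := by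
        gcongr
        exact finrank_colSpace_le A

/-- The constant `T` such that, for `k > 1`, an error keeps at most `σ² / 64` of its second moment
on an event of probability at most `1 / T`. For `σ = 0` the division by zero is harmless, since
then the errors vanish. -/
noncomputable def truncConst (k σ M : ℝ) : ℝ :=
  (64 * |M| ^ (1 / k) / σ ^ 2) ^ (k / (k - 1))

lemma truncConst_nonneg (k σ M : ℝ) : 0 ≤ truncConst k σ M := by
  unfold truncConst
  positivity

lemma ErrorModel.setIntegral_sq_le [IsProbabilityMeasure μ] (h : ErrorModel μ k σ M ε)
    (hk : 1 < k) {F : Set Ω} (hF : μ.real F * truncConst k σ M ≤ 1) (l : Fin n) :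
    ∫ ω in F, ε l ω ^ 2 ∂μ ≤ σ ^ 2 / 64 := by
  have hk0 : 0 < k := by linarith
  rcases eq_or_ne σ 0 with rfl | hσ
  · have hle := setIntegral_le_integral (s := F) (h.sq_integrable l).integrable_sq
      (Filter.Eventually.of_forall fun ω => sq_nonneg (ε l ω))
    rw [h.integral_sq] at hle
    simpa using hle
  have hholder : ∫ ω in F, ε l ω ^ 2 ∂μ ≤ |M| ^ (1 / k) * μ.real F ^ ((k - 1) / k) := by
    have hle := setIntegral_abs_rpow_le two_pos (by linarith) (h.memLp_rpow hk0 l) F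
    simp only [Real.rpow_two, sq_abs] at hle
    rw [show (2 : ℝ) / (2 * k) = 1 / k by field_simp,
      show 1 - 1 / k = (k - 1) / k by field_simp] at hle
    refine hle.trans ?_
    gcongr
    exact (h.moment_le l).trans (le_abs_self M)
  have hsmall : μ.real F ^ ((k - 1) / k) * (64 * |M| ^ (1 / k) / σ ^ 2) ≤ 1 := by
    have hpow := Real.rpow_le_one (mul_nonneg measureReal_nonneg (truncConst_nonneg k σ M)) hF
      (show 0 ≤ (k - 1) / k from div_nonneg (by linarith) hk0.le)
    rwa [Real.mul_rpow measureReal_nonneg (truncConst_nonneg k σ M), truncConst,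
      ← Real.rpow_mul (by positivity), div_mul_div_cancel₀ (by linarith), div_self hk0.ne',
      Real.rpow_one] at hpow
  rw [← mul_div_assoc, div_le_one (by positivity)] at hsmall
  linarith

lemma ErrorModel.setIntegral_fittedEnergy_le [IsProbabilityMeasure μ] [Fintype κ]
    (h : ErrorModel μ k σ M ε) (A : Matrix (Fin n) κ ℝ)
    (hcard : k ≤ 1 → (Fintype.card κ : ℝ) ≤ n / 64) {F : Set Ω}
    (hF : μ.real F * truncConst k σ M ≤ 1) :
    ∫ ω in F, fittedEnergy A (fun l => ε l ω) ∂μ ≤ n * σ ^ 2 / 64 := by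
  rcases le_or_gt k 1 with hk | hk
  · calc ∫ ω in F, fittedEnergy A (fun l => ε l ω) ∂μ
        ≤ ∫ ω, fittedEnergy A (fun l => ε l ω) ∂μ :=
          setIntegral_le_integral (h.integrable_fittedEnergy A)
            (Filter.Eventually.of_forall fun ω => fittedEnergy_nonneg _ _)
      _ ≤ n / 64 * σ ^ 2 := (h.integral_fittedEnergy_le_card A).trans (by gcongr; exact hcard hk)
      _ = n * σ ^ 2 / 64 := by ring
  · calc ∫ ω in F, fittedEnergy A (fun l => ε l ω) ∂μ
        ≤ ∫ ω in F, sqNorm (fun l => ε l ω) ∂μ :=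
          integral_mono (h.integrable_fittedEnergy A).integrableOn
            h.integrable_sqNorm.integrableOn fun _ => fittedEnergy_le_sqNorm _ _
      _ = ∑ l, ∫ ω in F, ε l ω ^ 2 ∂μ :=
          integral_finsetSum _ fun l _ => (h.sq_integrable l).integrable_sq.integrableOn
      _ ≤ ∑ _l : Fin n, σ ^ 2 / 64 := Finset.sum_le_sum fun l _ => h.setIntegral_sq_le hk hF l
      _ = n * σ ^ 2 / 64 := by simp [mul_div_assoc]

end NoiseEnergy

section ExtendZero

open Matrix

variable {r p : ℕ} {G : Finset (Fin p)}

/-- Extension by zero of coefficients in the model `G` to all features. -/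
def extendZero (a : G → ℝ) : Fin p → ℝ :=
  fun j => if h : j ∈ G then a ⟨j, h⟩ else 0

@[simp]
lemma extendZero_coe (a : G → ℝ) (j : G) : extendZero a j = a j := by
  simp [extendZero]

lemma extendZero_of_notMem (a : G → ℝ) {j : Fin p} (hj : j ∉ G) : extendZero a j = 0 :=
  dif_neg hj

lemma extendZero_restrict {v : Fin p → ℝ} (hv : ∀ j ∉ G, v j = 0) :
    extendZero (fun a : G => v a) = v := by
  ext j
  by_cases hj : j ∈ G
  · exact extendZero_coe _ ⟨j, hj⟩
  · rw [extendZero_of_notMem _ hj, hv j hj]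

lemma sum_extendZero {f : ℝ → ℝ} (hf : f 0 = 0) (a : G → ℝ) :
    ∑ j, f (extendZero a j) = ∑ j, f (a j) := by
  rw [← Finset.sum_subset (Finset.subset_univ G) fun j _ hj => by
    rw [extendZero_of_notMem a hj, hf], ← Finset.sum_coe_sort]
  simp only [extendZero_coe]

lemma sqNorm_extendZero (a : G → ℝ) : sqNorm (extendZero a) = sqNorm a :=
  sum_extendZero (f := (· ^ 2)) (zero_pow two_ne_zero) a

lemma cols_mulVec (X : Matrix (Fin r) (Fin p) ℝ) (a : G → ℝ) :
    cols X G *ᵥ a = X *ᵥ extendZero a := by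
  ext l
  calc (cols X G *ᵥ a) l = ∑ j : G, X l j * a j := rfl
    _ = ∑ j : G, X l j * extendZero a j := by simp only [extendZero_coe]
    _ = ∑ j ∈ G, X l j * extendZero a j :=
      Finset.sum_coe_sort G fun j => X l j * extendZero a j
    _ = (X *ᵥ extendZero a) l := Finset.sum_subset (Finset.subset_univ G) fun j _ hj => by
      rw [extendZero_of_notMem a hj, mul_zero]

lemma ols_eq (X : Matrix (Fin r) (Fin p) ℝ) (Y : Fin r → ℝ) (G : Finset (Fin p)) :
    ols X Y G = extendZero (lsCoef (cols X G) Y) :=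
  rfl

lemma mem_supp {β : Fin p → ℝ} {j : Fin p} : j ∈ supp β ↔ β j ≠ 0 := by
  simp [supp]

lemma extendZero_restrict_supp (β : Fin p → ℝ) :
    extendZero (fun a : supp β => β a) = β :=
  extendZero_restrict fun _ hj => not_not.1 fun hne => hj (mem_supp.2 hne)

end ExtendZero

section Lasso

open Matrix

variable {r p : ℕ} {X : Matrix (Fin r) (Fin p) ℝ} {Y w : Fin r → ℝ} {lam c η : ℝ}
  {b β : Fin p → ℝ}

/-- The dual vector of `b₀` in the Lasso problem: minus the gradient at `b₀` of the quadratic part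
of the loss. -/
noncomputable def lassoDual (X : Matrix (Fin r) (Fin p) ℝ) (Y : Fin r → ℝ) (b₀ : Fin p → ℝ) :
    Fin p → ℝ :=
  (2 / (r : ℝ)) • (Xᵀ *ᵥ (Y - X *ᵥ b₀))

lemma lassoDual_apply (b₀ : Fin p → ℝ) (j : Fin p) :
    lassoDual X Y b₀ j = 2 / r * (X.col j ⬝ᵥ (Y - X *ᵥ b₀)) :=
  rfl

lemma sqNorm_sub_mulVec (b₀ : Fin p → ℝ) :
    1 / (r : ℝ) * sqNorm (Y - X *ᵥ b) = 1 / (r : ℝ) * sqNorm (Y - X *ᵥ b₀) -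
      lassoDual X Y b₀ ⬝ᵥ (b - b₀) + 1 / (r : ℝ) * sqNorm (X *ᵥ (b - b₀)) := by
  have hsplit : Y - X *ᵥ b = Y - X *ᵥ b₀ - X *ᵥ (b - b₀) := by rw [mulVec_sub]; abel
  rw [hsplit, lassoDual, smul_dotProduct, mulVec_transpose, ← dotProduct_mulVec, smul_eq_mul]
  set R := Y - X *ᵥ b₀
  set d := X *ᵥ (b - b₀)
  simp only [sqNorm_eq_dotProduct, sub_dotProduct, dotProduct_sub]
  rw [dotProduct_comm d R]
  ring

lemma IsLasso.sqNorm_add_sum_le {b₀ : Fin p → ℝ} (hb : IsLasso lam X Y b)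
    (hu : ∀ j, lassoDual X Y b₀ j * b₀ j = lam * |b₀ j|) :
    1 / (r : ℝ) * sqNorm (X *ᵥ (b - b₀)) +
      ∑ j, (lam * |b j| - lassoDual X Y b₀ j * b j) ≤ 0 := by
  have hmin := hb b₀
  rw [lassoLoss, lassoLoss, sqNorm_sub_mulVec b₀, dotProduct_sub] at hmin
  have hb₀ : lassoDual X Y b₀ ⬝ᵥ b₀ = lam * ∑ j, |b₀ j| := by
    rw [Finset.mul_sum]
    exact Finset.sum_congr rfl fun j _ => hu j
  rw [Finset.sum_sub_distrib, ← Finset.mul_sum]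
  change _ + (_ - lassoDual X Y b₀ ⬝ᵥ b) ≤ 0
  linarith

lemma IsLasso.eq_of_lassoDual {b₀ : Fin p → ℝ} {S : Finset (Fin p)} (hr : 0 < r) (hc : 0 < c)
    (hX : BoundedBelow (cols X S) c) (hb : IsLasso lam X Y b)
    (hu : ∀ j, lassoDual X Y b₀ j * b₀ j = lam * |b₀ j|)
    (hu_le : ∀ j, |lassoDual X Y b₀ j| ≤ lam) (hu_lt : ∀ j ∉ S, |lassoDual X Y b₀ j| < lam)
    (hb₀ : ∀ j ∉ S, b₀ j = 0) : b = b₀ := by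
  set u := lassoDual X Y b₀
  have hterm : ∀ j, (lam - |u j|) * |b j| ≤ lam * |b j| - u j * b j := fun j => by
    have := le_abs_self (u j * b j)
    rw [abs_mul] at this
    linarith
  have hterm0 : ∀ j, 0 ≤ lam * |b j| - u j * b j := fun j =>
    (mul_nonneg (sub_nonneg.2 (hu_le j)) (abs_nonneg _)).trans (hterm j)
  have hgap := hb.sqNorm_add_sum_le hu
  have hsum0 := Finset.sum_nonneg fun j (_ : j ∈ Finset.univ) => hterm0 j
  have hX0 : 0 ≤ 1 / (r : ℝ) * sqNorm (X *ᵥ (b - b₀)) :=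
    mul_nonneg (by positivity) (sqNorm_nonneg _)
  have hoff : ∀ j ∉ S, b j = 0 := fun j hj => by
    have hz := (Finset.sum_eq_zero_iff_of_nonneg fun j _ => hterm0 j).1
      (le_antisymm (by linarith) hsum0) j (Finset.mem_univ j)
    by_contra hne
    exact absurd (hz ▸ hterm j) (not_le.2 (mul_pos (sub_pos.2 (hu_lt j hj)) (abs_pos.2 hne)))
  have hfit : sqNorm (X *ᵥ (b - b₀)) = 0 :=
    (mul_eq_zero.1 (le_antisymm (by linarith) hX0)).resolve_left (by positivity)
  have hext := extendZero_restrict (G := S) (v := b - b₀) fun j hj => by simp [hoff j hj, hb₀ j hj]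
  rw [← hext, ← cols_mulVec] at hfit
  rw [← sub_eq_zero, ← hext, hX.eq_zero hc hfit]
  exact extendZero_restrict fun _ _ => rfl

lemma abs_sign_of_ne_zero {x : ℝ} (hx : x ≠ 0) : |Real.sign x| = 1 := by
  rcases Real.sign_apply_eq_of_ne_zero x hx with h | h <;> simp [h]

lemma sign_mul_add_eq_abs {x y : ℝ} (h : |y| < |x|) : Real.sign x * (x + y) = |x + y| := by
  rcases lt_trichotomy x 0 with hx | rfl | hx
  · rw [abs_of_neg hx] at h
    rw [Real.sign_of_neg hx, abs_of_neg (by linarith [le_abs_self y]), neg_one_mul]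
  · exact absurd h (by simp)
  · rw [abs_of_pos hx] at h
    rw [Real.sign_of_pos hx, abs_of_pos (by linarith [neg_abs_le y]), one_mul]

/-- The direction `(X_Sᵀ X_S)⁻¹ sign(β_S)` in which the `ℓ¹` penalty shrinks the least squares
coefficients. -/
noncomputable def signDir (X : Matrix (Fin r) (Fin p) ℝ) (β : Fin p → ℝ) : supp β → ℝ :=
  (gram X (supp β))⁻¹ *ᵥ fun a => Real.sign (β a)

lemma BoundedBelow.mul_abs_signDir_le (hX : BoundedBelow (cols X (supp β)) c) (hc : 0 < c)
    (j : supp β) : c * |signDir X β j| ≤ Real.sqrt (supp β).card := by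
  have hsign : sqNorm (fun a : supp β => Real.sign (β a)) = (supp β).card := by
    have : ∀ a : supp β, Real.sign (β a) ^ 2 = 1 := fun a => by
      rw [← sq_abs, abs_sign_of_ne_zero (mem_supp.1 a.2), one_pow]
    simp [sqNorm, this]
  refine Real.le_sqrt_of_sq_le ?_
  rw [mul_pow, sq_abs, ← hsign]
  refine le_trans ?_ (hX.sq_mul_sqNorm_inv_mulVec_le hc _)
  gcongr
  exact sq_le_sqNorm _ j

lemma CondA3.abs_dotProduct_lt (h : CondA3 η X β) {j : Fin p} (hj : j ∉ supp β) :
    |X.col j ⬝ᵥ (cols X (supp β) *ᵥ signDir X β)| < 1 - η := by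
  have hlt := h ⟨j, Finset.mem_compl.2 hj⟩
  rwa [← mulVec_mulVec, ← mulVec_mulVec] at hlt

/-- The error `b₀ - β` on the true model `S` of the Lasso restricted to `S`, when the signs of `β`
are recovered: the least squares error, shrunk along `signDir`. -/
noncomputable def witnessError (lam : ℝ) (X : Matrix (Fin r) (Fin p) ℝ) (β : Fin p → ℝ)
    (w : Fin r → ℝ) : supp β → ℝ :=
  lsCoef (cols X (supp β)) w - (r * lam / 2) • signDir X β

/-- The primal witness: the Lasso estimate computed in the true model, extended by zero. -/
noncomputable def witness (lam : ℝ) (X : Matrix (Fin r) (Fin p) ℝ) (β : Fin p → ℝ)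
    (w : Fin r → ℝ) : Fin p → ℝ :=
  extendZero ((fun a : supp β => β a) + witnessError lam X β w)

lemma residual_witness (lam : ℝ) (X : Matrix (Fin r) (Fin p) ℝ) (β : Fin p → ℝ)
    (w : Fin r → ℝ) :
    X *ᵥ β + w - X *ᵥ witness lam X β w =
      lsResid (cols X (supp β)) w + (r * lam / 2) • (cols X (supp β) *ᵥ signDir X β) := by
  rw [witness, ← cols_mulVec, mulVec_add, cols_mulVec X fun a : supp β => β a,
    extendZero_restrict_supp, witnessError, mulVec_sub, mulVec_smul, lsResid]
  abel

lemma lassoDual_witness_of_mem (hr : 0 < r) (hc : 0 < c)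
    (hX : BoundedBelow (cols X (supp β)) c) (j : supp β) :
    lassoDual X (X *ᵥ β + w) (witness lam X β w) j = lam * Real.sign (β j) := by
  have hnormal : (cols X (supp β))ᵀ *ᵥ (X *ᵥ β + w - X *ᵥ witness lam X β w) =
      (r * lam / 2) • fun a : supp β => Real.sign (β a) := by
    rw [residual_witness, mulVec_add, hX.transpose_mulVec_lsResid hc, mulVec_smul, mulVec_mulVec,
      zero_add, signDir, gram, hX.mulVec_inv_mulVec hc]
  rw [lassoDual_apply]
  change 2 / (r : ℝ) * ((cols X (supp β))ᵀ *ᵥ (X *ᵥ β + w - X *ᵥ witness lam X β w)) j = _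
  rw [hnormal, Pi.smul_apply, smul_eq_mul]
  field_simp

lemma abs_lassoDual_witness_lt (hr : 0 < r) (hc : 0 < c) (hlam : 0 < lam)
    (hX : BoundedBelow (cols X (supp β)) c) (hirr : CondA3 η X β) {j : Fin p} (hj : j ∉ supp β)
    (hw : |lsResid (cols X (supp β)) (X.col j) ⬝ᵥ w| < η * lam * r / 2) :
    |lassoDual X (X *ᵥ β + w) (witness lam X β w) j| < lam := by
  have : (0 : ℝ) < r := Nat.cast_pos.2 hr
  have hirrj := hirr.abs_dotProduct_lt hj
  rw [lassoDual_apply, residual_witness, dotProduct_add, ← hX.lsResid_dotProduct hc,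
    dotProduct_smul, smul_eq_mul]
  set x := lsResid (cols X (supp β)) (X.col j) ⬝ᵥ w
  set y := X.col j ⬝ᵥ (cols X (supp β) *ᵥ signDir X β)
  calc |2 / r * (x + r * lam / 2 * y)| = |2 / r * x + lam * y| := by congr 1; field_simp
    _ ≤ |2 / r * x| + |lam * y| := abs_add_le _ _
    _ = 2 / r * |x| + lam * |y| := by
      rw [abs_mul, abs_mul, abs_of_pos hlam, abs_of_pos (by positivity : (0 : ℝ) < 2 / r)]
    _ < 2 / r * (η * lam * r / 2) + lam * (1 - η) := by gcongr
    _ = lam := by field_simp; ring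

lemma abs_witnessError_lt (hc : 0 < c) (hlam : 0 < lam)
    (hX : BoundedBelow (cols X (supp β)) c) (j : supp β)
    (hw : |lsWeight (cols X (supp β)) j ⬝ᵥ w| +
      r * lam / 2 * (Real.sqrt (supp β).card / c) < |β j|) :
    |witnessError lam X β w j| < |β j| := by
  refine lt_of_le_of_lt ?_ hw
  rw [witnessError, Pi.sub_apply, lsCoef_apply, Pi.smul_apply, smul_eq_mul]
  refine (abs_sub _ _).trans ?_
  rw [abs_mul, abs_of_nonneg (by positivity : 0 ≤ r * lam / 2)]
  gcongr
  rw [le_div_iff₀' hc]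
  exact hX.mul_abs_signDir_le hc j

lemma supp_witness (h : ∀ j, |witnessError lam X β w j| < |β j|) :
    supp (witness lam X β w) = supp β := by
  ext j
  by_cases hj : j ∈ supp β
  · have hne : β j + witnessError lam X β w ⟨j, hj⟩ ≠ 0 := fun h0 => by
      have := h ⟨j, hj⟩
      rw [← neg_eq_of_add_eq_zero_right h0, abs_neg] at this
      exact this.false
    rw [iff_true_right hj, mem_supp, witness, extendZero_coe _ ⟨j, hj⟩]
    exact hne
  · rw [iff_false_right hj, mem_supp, witness, extendZero_of_notMem _ hj]
    exact not_not.2 rfl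

lemma IsLasso.supp_eq (hr : 0 < r) (hc : 0 < c) (hlam : 0 < lam)
    (hX : BoundedBelow (cols X (supp β)) c) (hirr : CondA3 η X β)
    (hon : ∀ j : supp β, |lsWeight (cols X (supp β)) j ⬝ᵥ w| +
      r * lam / 2 * (Real.sqrt (supp β).card / c) < |β j|)
    (hoff : ∀ j ∉ supp β, |lsResid (cols X (supp β)) (X.col j) ⬝ᵥ w| < η * lam * r / 2)
    (hb : IsLasso lam X (X *ᵥ β + w) b) : supp b = supp β := by
  have herr := fun j => abs_witnessError_lt hc hlam hX j (hon j)
  have hzero : ∀ j ∉ supp β, witness lam X β w j = 0 := fun j hj => extendZero_of_notMem _ hj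
  have hdual := lassoDual_witness_of_mem (lam := lam) (w := w) hr hc hX
  have hdual_lt : ∀ j ∉ supp β, |lassoDual X (X *ᵥ β + w) (witness lam X β w) j| < lam :=
    fun j hj => abs_lassoDual_witness_lt hr hc hlam hX hirr hj (hoff j hj)
  have hb₀ : b = witness lam X β w := by
    refine hb.eq_of_lassoDual hr hc hX (fun j => ?_) (fun j => ?_) hdual_lt hzero
    · by_cases hj : j ∈ supp β
      · rw [hdual ⟨j, hj⟩, mul_assoc, witness, extendZero_coe _ ⟨j, hj⟩, Pi.add_apply,
          sign_mul_add_eq_abs (herr ⟨j, hj⟩)]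
      · rw [hzero j hj, mul_zero, abs_zero, mul_zero]
    · by_cases hj : j ∈ supp β
      · rw [hdual ⟨j, hj⟩, abs_mul, abs_of_pos hlam, abs_sign_of_ne_zero (mem_supp.1 hj), mul_one]
      · exact (hdual_lt j hj).le
  rw [hb₀, supp_witness herr]

end Lasso

section BlockFailure

open Matrix

variable {Ω : Type*} [MeasurableSpace Ω] {μ : Measure Ω} {k σ M : ℝ} {r p : ℕ}
  {X : Matrix (Fin r) (Fin p) ℝ} {S : Finset (Fin p)} {t₁ t₂ : ℝ}

/-- The direction whose inner product with the noise decides whether the Lasso classifies the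
feature `j` correctly: the least squares weights of `j` for `j ∈ S`, and the part of column `j`
orthogonal to the columns of `S` otherwise. -/
noncomputable def noiseDir (X : Matrix (Fin r) (Fin p) ℝ) (S : Finset (Fin p)) (j : Fin p) :
    Fin r → ℝ :=
  if h : j ∈ S then lsWeight (cols X S) ⟨j, h⟩ else lsResid (cols X S) (X.col j)

lemma noiseDir_of_mem (j : S) : noiseDir X S j = lsWeight (cols X S) j :=
  dif_pos j.2

lemma noiseDir_of_notMem {j : Fin p} (hj : j ∉ S) :
    noiseDir X S j = lsResid (cols X S) (X.col j) :=
  dif_neg hj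

/-- The noise vectors that are large in one of the directions `noiseDir X S j`, where large means
at least `t₁` for the features of `S` and at least `t₂` for the others. -/
def failSet (X : Matrix (Fin r) (Fin p) ℝ) (S : Finset (Fin p)) (t₁ t₂ : ℝ) : Set (Fin r → ℝ) :=
  {w | ∃ j, (if j ∈ S then t₁ else t₂) ≤ |noiseDir X S j ⬝ᵥ w|}

lemma failSet_eq_iUnion :
    failSet X S t₁ t₂ = ⋃ j, {w | (if j ∈ S then t₁ else t₂) ≤ |noiseDir X S j ⬝ᵥ w|} := by
  ext w
  simp [failSet]

lemma measurableSet_failSet : MeasurableSet (failSet X S t₁ t₂) := by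
  rw [failSet_eq_iUnion]
  refine MeasurableSet.iUnion fun j => measurableSet_le measurable_const ?_
  unfold dotProduct
  fun_prop

lemma IsLasso.supp_eq_of_notMem_failSet {β b : Fin p → ℝ} {w : Fin r → ℝ} {lam c η : ℝ}
    (hr : 0 < r) (hc : 0 < c) (hlam : 0 < lam) (hX : BoundedBelow (cols X (supp β)) c)
    (hirr : CondA3 η X β)
    (hsig : ∀ j ∈ supp β, t₁ + r * lam / 2 * (Real.sqrt (supp β).card / c) ≤ |β j|)
    (hw : w ∉ failSet X (supp β) t₁ (η * lam * r / 2))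
    (hb : IsLasso lam X (X *ᵥ β + w) b) : supp b = supp β := by
  have hsmall : ∀ j, |noiseDir X (supp β) j ⬝ᵥ w| <
      if j ∈ supp β then t₁ else η * lam * r / 2 := by
    simpa [failSet] using hw
  refine hb.supp_eq hr hc hlam hX hirr (fun j => ?_) fun j hj => ?_
  · have hj := hsmall j
    rw [if_pos j.2, noiseDir_of_mem] at hj
    linarith [hsig j j.2]
  · simpa only [if_neg hj, noiseDir_of_notMem hj] using hsmall j

lemma ErrorModel.measureReal_failSet_le [IsProbabilityMeasure μ] {ε : Fin r → Ω → ℝ} {D : ℝ}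
    (h : ErrorModel μ k σ M ε) (hk : 0 < k) (ht₁ : 0 < t₁) (ht₂ : 0 < t₂)
    (h₁ : ∀ j : S, sqNorm (lsWeight (cols X S) j) ≤ D * t₁ ^ 2)
    (h₂ : ∀ j ∉ S, sqNorm (lsResid (cols X S) (X.col j)) ≤ D * t₂ ^ 2) :
    μ.real ((fun ω l => ε l ω) ⁻¹' failSet X S t₁ t₂) ≤ p * (tailConst k σ M * D ^ k) := by
  rw [failSet_eq_iUnion, Set.preimage_iUnion]
  refine (measureReal_iUnion_fintype_le _).trans ?_
  have htail : ∀ j, μ.real ((fun ω l => ε l ω) ⁻¹'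
      {w | (if j ∈ S then t₁ else t₂) ≤ |noiseDir X S j ⬝ᵥ w|}) ≤ tailConst k σ M * D ^ k := by
    intro j
    have ht : 0 < if j ∈ S then t₁ else t₂ := by split_ifs <;> assumption
    have hdir : sqNorm (noiseDir X S j) ≤ D * (if j ∈ S then t₁ else t₂) ^ 2 := by
      by_cases hj : j ∈ S
      · simpa only [noiseDir_of_mem ⟨j, hj⟩, if_pos hj] using h₁ ⟨j, hj⟩
      · simpa only [noiseDir_of_notMem hj, if_neg hj] using h₂ j hj
    refine (h.measureReal_le_abs_sum_le hk (noiseDir X S j) ht).trans ?_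
    gcongr
    · exact (tailConst_pos k σ M).le
    · exact div_nonneg (sqNorm_nonneg _) (sq_nonneg _)
    · rwa [div_le_iff₀ (by positivity)]
  refine (Finset.sum_le_sum fun j _ => htail j).trans_eq ?_
  simp

lemma CondA1.boundedBelow {V₁ V₂ : ℝ} {β : Fin p → ℝ} (h : CondA1 V₁ V₂ X β) (hr : 0 < r) :
    BoundedBelow (cols X (supp β)) (r * V₂) :=
  h.eig_ge.boundedBelow (Nat.cast_pos.2 hr)

lemma CondA1.sqNorm_col_le {V₁ V₂ : ℝ} {β : Fin p → ℝ} (h : CondA1 V₁ V₂ X β) (hr : 0 < r)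
    (j : Fin p) : sqNorm (X.col j) ≤ r * V₁ := by
  have hj := h.col_le j
  rwa [one_div, inv_mul_eq_div, div_le_iff₀' (Nat.cast_pos.2 hr)] at hj

end BlockFailure

section Rates

variable {k ι τ V₁ V₂ c₀ c₁ c₂ η : ℝ} {r p : ℕ}

/-- The penalty `c₀ r^{-(ι-τ+1)/2}` of the Lasso on a block of `r` observations. -/
noncomputable def penalty (c₀ ι τ : ℝ) (r : ℕ) : ℝ :=
  c₀ * (r : ℝ) ^ (-((ι - τ + 1) / 2))

/-- What is left of the signal strength constant `c₂` after the shrinkage of the Lasso. -/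
noncomputable def signalGap (V₂ c₀ c₁ c₂ : ℝ) : ℝ :=
  c₂ - c₀ * Real.sqrt c₁ / (2 * V₂)

/-- The noise level in the true features from which the Lasso on `r` observations may fail. -/
noncomputable def signalThreshold (τ V₂ c₀ c₁ c₂ : ℝ) (r : ℕ) : ℝ :=
  signalGap V₂ c₀ c₁ c₂ * (r : ℝ) ^ (-((1 - τ) / 2))

/-- The constant `D` for which `D r^{-(τ-ι)}` bounds the ratio of `‖noiseDir‖²` to the square of the
corresponding threshold; its two terms come from the features inside and outside the model. -/
noncomputable def rateConst (V₁ V₂ c₀ c₁ c₂ η : ℝ) : ℝ :=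
  1 / (V₂ * signalGap V₂ c₀ c₁ c₂ ^ 2) + 4 * V₁ / (η ^ 2 * c₀ ^ 2)

lemma penalty_pos (hr : 0 < r) (hc₀ : 0 < c₀) : 0 < penalty c₀ ι τ r := by
  unfold penalty
  positivity

lemma signalGap_pos (hc₁ : 0 < c₁) (hV₂ : 0 < V₂) (hc₀' : c₀ < 2 * c₂ * V₂ / Real.sqrt c₁) :
    0 < signalGap V₂ c₀ c₁ c₂ := by
  rw [lt_div_iff₀ (Real.sqrt_pos.2 hc₁)] at hc₀'
  rw [signalGap, sub_pos, div_lt_iff₀ (by positivity)]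
  linarith

lemma signalThreshold_add_le_abs (hr : 0 < r) (hV₂ : 0 < V₂) (hc₁ : 0 < c₁) (hc₀ : 0 < c₀)
    {β : Fin p → ℝ} (h : CondA2 c₁ c₂ ι τ r β) {j : Fin p} (hj : j ∈ supp β) :
    signalThreshold τ V₂ c₀ c₁ c₂ r +
      r * penalty c₀ ι τ r / 2 * (Real.sqrt (supp β).card / (r * V₂)) ≤ |β j| := by
  have hr' : (0 : ℝ) < r := Nat.cast_pos.2 hr
  have hsqrt : Real.sqrt (supp β).card ≤ Real.sqrt c₁ * (r : ℝ) ^ (ι / 2) := by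
    refine (Real.sqrt_le_sqrt h.sparse).trans_eq ?_
    rw [Real.sqrt_mul hc₁.le, Real.sqrt_eq_rpow ((r : ℝ) ^ ι), ← Real.rpow_mul hr'.le,
      mul_one_div]
  have hpow : (r : ℝ) ^ (-((ι - τ + 1) / 2)) * (r : ℝ) ^ (ι / 2) = (r : ℝ) ^ (-((1 - τ) / 2)) := by
    rw [← Real.rpow_add hr']
    ring_nf
  have hshrink : r * penalty c₀ ι τ r / 2 * (Real.sqrt (supp β).card / (r * V₂)) ≤
      c₀ * Real.sqrt c₁ / (2 * V₂) * (r : ℝ) ^ (-((1 - τ) / 2)) := by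
    calc r * penalty c₀ ι τ r / 2 * (Real.sqrt (supp β).card / (r * V₂))
        = penalty c₀ ι τ r * Real.sqrt (supp β).card / (2 * V₂) := by field_simp
      _ ≤ penalty c₀ ι τ r * (Real.sqrt c₁ * (r : ℝ) ^ (ι / 2)) / (2 * V₂) := by
        have := penalty_pos (ι := ι) (τ := τ) hr hc₀
        gcongr
      _ = c₀ * Real.sqrt c₁ / (2 * V₂) * (r : ℝ) ^ (-((1 - τ) / 2)) := by
        rw [← hpow, penalty]
        ring
  have hsignal := h.signal j hj
  rw [signalThreshold, signalGap, sub_mul]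
  linarith

lemma rpow_neg_half_sq {x : ℝ} (hx : 0 ≤ x) (a : ℝ) : (x ^ (-(a / 2))) ^ 2 = x ^ (-a) := by
  rw [← Real.rpow_mul_natCast hx]
  congr 1
  push_cast
  ring

lemma rateConst_pos (hV₁ : 0 ≤ V₁) (hV₂ : 0 < V₂) (hg : 0 < signalGap V₂ c₀ c₁ c₂) :
    0 < rateConst V₁ V₂ c₀ c₁ c₂ η := by
  unfold rateConst
  positivity

lemma inv_le_rate_mul_signalThreshold_sq (hr : 0 < r) (hι : 0 ≤ ι) (hV₁ : 0 ≤ V₁) (hV₂ : 0 < V₂)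
    (hg : 0 < signalGap V₂ c₀ c₁ c₂) :
    1 / (r * V₂) ≤ rateConst V₁ V₂ c₀ c₁ c₂ η * (r : ℝ) ^ (-(τ - ι)) *
      signalThreshold τ V₂ c₀ c₁ c₂ r ^ 2 := by
  have hr' : (0 : ℝ) < r := Nat.cast_pos.2 hr
  have hpow : (r : ℝ) ^ (-(τ - ι)) * (r : ℝ) ^ (-(1 - τ)) = (r : ℝ)⁻¹ * (r : ℝ) ^ ι := by
    rw [← Real.rpow_add hr', ← Real.rpow_neg_one, ← Real.rpow_add hr']
    ring_nf
  have hone : (1 : ℝ) ≤ (r : ℝ) ^ ι := Real.one_le_rpow (Nat.one_le_cast.2 hr) hι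
  have hD : 1 / (V₂ * signalGap V₂ c₀ c₁ c₂ ^ 2) ≤ rateConst V₁ V₂ c₀ c₁ c₂ η :=
    le_add_of_nonneg_right (by positivity)
  rw [signalThreshold, mul_pow, rpow_neg_half_sq hr'.le]
  set g := signalGap V₂ c₀ c₁ c₂
  set D := rateConst V₁ V₂ c₀ c₁ c₂ η
  calc 1 / (r * V₂) = 1 / (V₂ * g ^ 2) * g ^ 2 * ((r : ℝ)⁻¹ * 1) := by field_simp
    _ ≤ D * g ^ 2 * ((r : ℝ)⁻¹ * (r : ℝ) ^ ι) := by
      have : 0 ≤ D := hD.trans' (by positivity)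
      gcongr
    _ = D * (r : ℝ) ^ (-(τ - ι)) * (g ^ 2 * (r : ℝ) ^ (-(1 - τ))) := by
      rw [← hpow]
      ring

lemma le_rate_mul_penalty_sq (hr : 0 < r) (hη : 0 < η) (hc₀ : 0 < c₀) (hV₂ : 0 < V₂) :
    r * V₁ ≤ rateConst V₁ V₂ c₀ c₁ c₂ η * (r : ℝ) ^ (-(τ - ι)) *
      (η * penalty c₀ ι τ r * r / 2) ^ 2 := by
  have hr' : (0 : ℝ) < r := Nat.cast_pos.2 hr
  have hpow : (r : ℝ) ^ (-(τ - ι)) * (r : ℝ) ^ (-(ι - τ + 1)) = (r : ℝ)⁻¹ := by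
    rw [← Real.rpow_add hr', ← Real.rpow_neg_one]
    ring_nf
  have hD : 4 * V₁ / (η ^ 2 * c₀ ^ 2) ≤ rateConst V₁ V₂ c₀ c₁ c₂ η :=
    le_add_of_nonneg_left (by positivity)
  set D := rateConst V₁ V₂ c₀ c₁ c₂ η
  calc r * V₁ = 4 * V₁ / (η ^ 2 * c₀ ^ 2) * (η ^ 2 * c₀ ^ 2 * (r : ℝ) ^ 2 / 4 * (r : ℝ)⁻¹) := by
        field_simp
    _ ≤ D * (η ^ 2 * c₀ ^ 2 * (r : ℝ) ^ 2 / 4 * (r : ℝ)⁻¹) := by gcongr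
    _ = D * (r : ℝ) ^ (-(τ - ι)) * (η * penalty c₀ ι τ r * r / 2) ^ 2 := by
      rw [← hpow, ← rpow_neg_half_sq hr'.le (ι - τ + 1), penalty]
      ring

/-- The noise vectors on a block with design `X` for which the Lasso may miss the true model. -/
def badNoise (τ ι V₂ c₀ c₁ c₂ η : ℝ) (X : Matrix (Fin r) (Fin p) ℝ) (β : Fin p → ℝ) :
    Set (Fin r → ℝ) :=
  failSet X (supp β) (signalThreshold τ V₂ c₀ c₁ c₂ r) (η * penalty c₀ ι τ r * r / 2)

lemma IsLasso.supp_eq_of_notMem_badNoise {X : Matrix (Fin r) (Fin p) ℝ} {β b : Fin p → ℝ}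
    {w : Fin r → ℝ} (hr : 0 < r) (hV₂ : 0 < V₂) (hc₁ : 0 < c₁) (hc₀ : 0 < c₀)
    (hA1 : CondA1 V₁ V₂ X β) (hA2 : CondA2 c₁ c₂ ι τ r β) (hA3 : CondA3 η X β)
    (hw : w ∉ badNoise τ ι V₂ c₀ c₁ c₂ η X β)
    (hb : IsLasso (penalty c₀ ι τ r) X (X.mulVec β + w) b) : supp b = supp β :=
  hb.supp_eq_of_notMem_failSet hr (by positivity) (penalty_pos hr hc₀) (hA1.boundedBelow hr) hA3
    (fun _ hj => signalThreshold_add_le_abs hr hV₂ hc₁ hc₀ hA2 hj) hw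

lemma ErrorModel.measureReal_badNoise_le {Ω : Type*} [MeasurableSpace Ω] {μ : Measure Ω}
    [IsProbabilityMeasure μ] {σ M : ℝ} {ε : Fin r → Ω → ℝ} {X : Matrix (Fin r) (Fin p) ℝ}
    {β : Fin p → ℝ} (h : ErrorModel μ k σ M ε) (hk : 0 < k) (hι : 0 ≤ ι) (hr : 0 < r)
    (hV₁ : 0 ≤ V₁) (hV₂ : 0 < V₂) (hη : 0 < η) (hc₀ : 0 < c₀) (hg : 0 < signalGap V₂ c₀ c₁ c₂)
    (hA1 : CondA1 V₁ V₂ X β) :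
    μ.real ((fun ω l => ε l ω) ⁻¹' badNoise τ ι V₂ c₀ c₁ c₂ η X β) ≤
      p * (tailConst k σ M * (rateConst V₁ V₂ c₀ c₁ c₂ η * (r : ℝ) ^ (-(τ - ι))) ^ k) := by
  have hc : 0 < r * V₂ := by positivity
  have hX := hA1.boundedBelow hr
  have hpen := penalty_pos (ι := ι) (τ := τ) hr hc₀
  exact h.measureReal_failSet_le hk (mul_pos hg (by positivity)) (by positivity)
    (fun j => (hX.sqNorm_lsWeight_le hc j).trans
      (inv_le_rate_mul_signalThreshold_sq hr hι hV₁ hV₂ hg))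
    fun j _ => ((hX.sqNorm_lsResid_le hc _).trans (hA1.sqNorm_col_le hr j)).trans
      (le_rate_mul_penalty_sq hr hη hc₀ hV₂)

/-- The constant `C₀` of the theorem. The factor `64 + truncConst k σ M` makes the failure
probability of a block small enough both for the majority vote and for the truncation of the noise
energy. -/
noncomputable def recoveryConst (k σ M V₁ V₂ c₀ c₁ c₂ η : ℝ) : ℝ :=
  64 + tailConst k σ M * rateConst V₁ V₂ c₀ c₁ c₂ η ^ k * (64 + truncConst k σ M)

lemma recoveryConst_ge {σ M : ℝ} (hV₁ : 0 ≤ V₁) (hV₂ : 0 < V₂)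
    (hg : 0 < signalGap V₂ c₀ c₁ c₂) : 64 ≤ recoveryConst k σ M V₁ V₂ c₀ c₁ c₂ η := by
  have := tailConst_pos k σ M
  have := truncConst_nonneg k σ M
  have := rateConst_pos (η := η) hV₁ hV₂ hg
  exact le_add_of_nonneg_right (by positivity)

lemma mul_rate_le_one {K D T δ : ℝ} (hr : 0 < r) (hK : 0 ≤ K) (hD : 0 ≤ D) (hT : 0 ≤ T)
    (hδ : δ ≤ 1)
    (hpr : (p : ℝ) ≤ δ / (64 + K * D ^ k * T) * (r : ℝ) ^ (k * τ - k * ι)) :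
    p * (K * (D * (r : ℝ) ^ (-(τ - ι))) ^ k) * T ≤ 1 := by
  have hr' : (0 : ℝ) < r := Nat.cast_pos.2 hr
  have hpow : (D * (r : ℝ) ^ (-(τ - ι))) ^ k = D ^ k * ((r : ℝ) ^ (k * τ - k * ι))⁻¹ := by
    rw [Real.mul_rpow hD (by positivity), ← Real.rpow_mul hr'.le, ← Real.rpow_neg hr'.le]
    ring_nf
  rw [hpow]
  set R := (r : ℝ) ^ (k * τ - k * ι)
  have hR : 0 < R := by positivity
  calc (p : ℝ) * (K * (D ^ k * R⁻¹)) * T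
      ≤ δ / (64 + K * D ^ k * T) * R * (K * (D ^ k * R⁻¹)) * T := by gcongr
    _ = δ * (K * D ^ k * T / (64 + K * D ^ k * T)) := by field_simp
    _ ≤ 1 * (K * D ^ k * T / (64 + K * D ^ k * T)) := by gcongr
    _ ≤ 1 := by
      rw [one_mul, div_le_one (by positivity)]
      linarith

lemma le_mul_of_le_mul_rpow {x A c κ : ℝ} (hr : 0 < r) (hκ : κ ≤ 1) (hA : A ≤ c) (hc : 0 ≤ c)
    (hx : x ≤ A * (r : ℝ) ^ κ) : x ≤ c * r := by
  refine hx.trans (mul_le_mul hA ?_ (by positivity) hc)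
  exact (Real.rpow_le_rpow_of_exponent_le (Nat.one_le_cast.2 hr) hκ).trans_eq (Real.rpow_one _)

end Rates

section NumberOfBlocks

lemma pos_of_one_le_floor_arg {κ A : ℝ} {n p : ℕ} (hκ : κ ≠ 0)
    (h : 1 ≤ A ^ κ⁻¹ * n / (p : ℝ) ^ κ⁻¹) : 0 < n ∧ 0 < p := by
  refine ⟨Nat.pos_of_ne_zero fun h0 => ?_, Nat.pos_of_ne_zero fun h0 => ?_⟩
  · rw [h0, Nat.cast_zero, mul_zero, zero_div] at h
    exact absurd h (by norm_num)
  · rw [h0, Nat.cast_zero, Real.zero_rpow (inv_ne_zero hκ), div_zero] at h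
    exact absurd h (by norm_num)

lemma le_mul_rpow_of_mul_le {κ A : ℝ} {p m r : ℕ} (hκ : 0 < κ) (hA : 0 ≤ A) (hp : 0 < p)
    (hm : 0 < m) (h : (m : ℝ) ≤ A ^ κ⁻¹ * (m * r : ℕ) / (p : ℝ) ^ κ⁻¹) :
    (p : ℝ) ≤ A * (r : ℝ) ^ κ := by
  have hm' : (0 : ℝ) < m := Nat.cast_pos.2 hm
  have hroot : (p : ℝ) ^ κ⁻¹ ≤ A ^ κ⁻¹ * r := by
    rw [le_div_iff₀ (by positivity), Nat.cast_mul] at h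
    exact le_of_mul_le_mul_left (h.trans_eq (by ring)) hm'
  calc (p : ℝ) = ((p : ℝ) ^ κ⁻¹) ^ κ := (Real.rpow_inv_rpow (Nat.cast_nonneg p) hκ.ne').symm
    _ ≤ (A ^ κ⁻¹ * r) ^ κ := by gcongr
    _ = A * (r : ℝ) ^ κ := by
      rw [Real.mul_rpow (by positivity) (by positivity), Real.rpow_inv_rpow hA hκ.ne']

variable {C₀ δ k τ ι α : ℝ} {n p m : ℕ}

lemma half_pow_le_failBound (hC₀ : 0 ≤ C₀) (hδ : 0 ≤ δ) (hδ' : δ ≤ 1 / 2) (hκ : 0 ≤ k * τ - k * ι)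
    (hn : 0 < n) (hp : 0 < p) (hpα : (p : ℝ) ≤ (n : ℝ) ^ α) (hm1 : 1 ≤ m)
    (hm : (δ / C₀) ^ (k * τ - k * ι)⁻¹ * (n : ℝ) / (p : ℝ) ^ (k * τ - k * ι)⁻¹ < m + 1) :
    (1 / 2 : ℝ) ^ m ≤ failBound C₀ δ k τ ι α n := by
  set κ := k * τ - k * ι with hκdef
  have hn' : (0 : ℝ) < n := Nat.cast_pos.2 hn
  set y := (δ / C₀) ^ κ⁻¹ * (n : ℝ) ^ (1 - α * κ⁻¹) with hy
  have hyx : y ≤ (δ / C₀) ^ κ⁻¹ * (n : ℝ) / (p : ℝ) ^ κ⁻¹ := by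
    rw [hy, mul_div_assoc, Real.rpow_sub hn', Real.rpow_one, Real.rpow_mul hn'.le]
    gcongr
  have hy0 : 0 ≤ y := by positivity
  have hy2m : y ≤ 2 * m := by
    have : (1 : ℝ) ≤ m := Nat.one_le_cast.2 hm1
    linarith
  have hcoef : (1 / 2 - δ) ^ 2 / (2 * (1 - δ)) ≤ 1 / 4 := by
    rw [div_le_iff₀ (by linarith)]
    nlinarith
  have hexp : (1 / 2 - δ) ^ 2 / (2 * (1 - δ)) * y ≤ m / 2 := by
    linarith [mul_le_mul_of_nonneg_right hcoef hy0]
  calc (1 / 2 : ℝ) ^ m ≤ Real.exp (-(1 / 2)) ^ m := by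
        gcongr
        linarith [Real.add_one_le_exp (-(1 / 2) : ℝ)]
    _ = Real.exp (-(m / 2)) := by rw [← Real.exp_nat_mul]; ring_nf
    _ ≤ failBound C₀ δ k τ ι α n := by
      rw [failBound, ← hκdef, mul_assoc _ ((δ / C₀) ^ κ⁻¹), ← hy]
      gcongr

lemma two_mul_quarter_pow_le (hm : 1 ≤ m) : 2 * (1 / 4 : ℝ) ^ m ≤ (1 / 2) ^ m := by
  have hsplit : (1 / 4 : ℝ) ^ m = (1 / 2) ^ m * (1 / 2) ^ m := by rw [← mul_pow]; norm_num
  have hhalf : (1 / 2 : ℝ) ^ m ≤ 1 / 2 :=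
    pow_le_of_le_one (by norm_num) (by norm_num) (Nat.one_le_iff_ne_zero.1 hm)
  rw [hsplit, ← mul_assoc]
  exact mul_le_of_le_one_left (by positivity) (by linarith)

end NumberOfBlocks

section LossInWrongModel

open Matrix

lemma sqNorm_mulVec_le {ι κ : Type*} [Fintype ι] [Fintype κ] {A : Matrix ι κ ℝ} {d : ℝ}
    (hA : ∀ j, sqNorm (A.col j) ≤ d) (v : κ → ℝ) :
    sqNorm (A *ᵥ v) ≤ Fintype.card κ * d * sqNorm v := by
  calc sqNorm (A *ᵥ v) ≤ ∑ l, sqNorm (A l) * sqNorm v :=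
        Finset.sum_le_sum fun l _ => dotProduct_sq_le (A l) v
    _ = (∑ j, sqNorm (A.col j)) * sqNorm v := by
        rw [← Finset.sum_mul]
        congr 1
        exact Finset.sum_comm
    _ ≤ Fintype.card κ * d * sqNorm v := by
        refine mul_le_mul_of_nonneg_right ?_ (sqNorm_nonneg v)
        exact (Finset.sum_le_sum fun j _ => hA j).trans_eq (by simp)

variable {r p : ℕ} {X : Matrix (Fin r) (Fin p) ℝ} {G : Finset (Fin p)} {c d : ℝ}
  {β : Fin p → ℝ}

lemma sqNorm_mulVec_le_of_support {S : Finset (Fin p)} (hX : ∀ j, sqNorm (X.col j) ≤ d)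
    {v : Fin p → ℝ} (hv : ∀ j ∉ S, v j = 0) : sqNorm (X *ᵥ v) ≤ S.card * d * sqNorm v := by
  have hcols := sqNorm_mulVec_le (A := cols X S) (fun j => hX j) fun a => v a
  rwa [cols_mulVec, ← sqNorm_extendZero, extendZero_restrict hv, Fintype.card_coe] at hcols

lemma BoundedBelow.ols_mulVec_add_sub (h : BoundedBelow (cols X G) c) (hc : 0 < c)
    (β : Fin p → ℝ) (w : Fin r → ℝ) :
    ols X (X *ᵥ β + w) G - β =
      extendZero (lsCoef (cols X G) (X *ᵥ (G : Set (Fin p))ᶜ.indicator β + w)) -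
        (G : Set (Fin p))ᶜ.indicator β := by
  set β' := (G : Set (Fin p))ᶜ.indicator β with hβ'
  have hsplit : β = extendZero (fun a : G => β a) + β' := by
    ext j
    by_cases hj : j ∈ G <;> simp [extendZero, hβ', hj]
  have hresponse : X *ᵥ β + w = cols X G *ᵥ (fun a => β a) + (X *ᵥ β' + w) := by
    rw [cols_mulVec, ← add_assoc, ← mulVec_add, ← hsplit]
  rw [ols_eq, hresponse, h.lsCoef_mulVec_add hc]
  ext j
  by_cases hj : j ∈ G <;> simp [extendZero, hβ', hj]

lemma BoundedBelow.ols_mulVec_add_sub_supp (h : BoundedBelow (cols X (supp β)) c) (hc : 0 < c)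
    (w : Fin r → ℝ) : ols X (X *ᵥ β + w) (supp β) - β = ols X w (supp β) := by
  have hzero : (supp β : Set (Fin p))ᶜ.indicator β = 0 := by
    ext j
    simp [Set.indicator_apply, supp]
  rw [h.ols_mulVec_add_sub hc, hzero, mulVec_zero, zero_add, sub_zero, ols_eq]

lemma sqNorm_extendZero_sub_indicator (a : G → ℝ) (β : Fin p → ℝ) :
    sqNorm (extendZero a - (G : Set (Fin p))ᶜ.indicator β) =
      sqNorm a + sqNorm ((G : Set (Fin p))ᶜ.indicator β) := by
  rw [← sqNorm_extendZero a, sqNorm, sqNorm, sqNorm, ← Finset.sum_add_distrib]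
  refine Finset.sum_congr rfl fun j _ => ?_
  by_cases hj : j ∈ G <;> simp [extendZero, hj]

lemma sqNorm_indicator_le {κ : Type*} [Fintype κ] (s : Set κ) (v : κ → ℝ) :
    sqNorm (s.indicator v) ≤ sqNorm v := by
  classical
  refine Finset.sum_le_sum fun j _ => ?_
  rw [Set.indicator_apply]
  split_ifs <;> simp [sq_nonneg]

lemma fittedEnergy_mulVec_indicator_add_le (hX : ∀ j, sqNorm (X.col j) ≤ d) (hd : 0 ≤ d)
    (T : Set (Fin p)) (β : Fin p → ℝ) (w : Fin r → ℝ) :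
    fittedEnergy X (X *ᵥ T.indicator β + w) ≤
      2 * ((supp β).card * d * sqNorm β) + 2 * fittedEnergy X w := by
  have hoff : ∀ j ∉ supp β, T.indicator β j = 0 := fun j hj => by
    rw [Set.indicator_apply_eq_zero]
    exact fun _ => not_not.1 fun hne => hj (mem_supp.2 hne)
  refine (fittedEnergy_add_le X _ w).trans ?_
  gcongr
  calc fittedEnergy X (X *ᵥ T.indicator β) ≤ sqNorm (X *ᵥ T.indicator β) :=
        fittedEnergy_le_sqNorm _ _
    _ ≤ (supp β).card * d * sqNorm (T.indicator β) := sqNorm_mulVec_le_of_support hX hoff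
    _ ≤ (supp β).card * d * sqNorm β := by
        gcongr
        exact sqNorm_indicator_le T β

lemma BoundedBelow.sqNorm_ols_sub_le (h : BoundedBelow (cols X G) c) (hc : 0 < c)
    (hX : ∀ j, sqNorm (X.col j) ≤ d) (hd : 0 ≤ d) (β : Fin p → ℝ) (w : Fin r → ℝ) :
    sqNorm (ols X (X *ᵥ β + w) G - β) ≤
      (1 + 2 * (supp β).card * d / c) * sqNorm β + 2 / c * fittedEnergy X w := by
  rw [h.ols_mulVec_add_sub hc, sqNorm_extendZero_sub_indicator]
  set β' := (G : Set (Fin p))ᶜ.indicator β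
  have hcoef : c * sqNorm (lsCoef (cols X G) (X *ᵥ β' + w)) ≤
      2 * ((supp β).card * d * sqNorm β) + 2 * fittedEnergy X w := by
    refine (h.mul_sqNorm_lsCoef_le hc (fun v => ?_) (fittedEnergy_nonneg X (X *ᵥ β' + w))).trans
      (fittedEnergy_mulVec_indicator_add_le hX hd _ β w)
    rw [cols_mulVec]
    exact mulVec_dotProduct_sq_le X _ _
  rw [← le_div_iff₀' hc] at hcoef
  refine (add_le_add hcoef (sqNorm_indicator_le _ β)).trans_eq ?_
  field_simp
  ring

end LossInWrongModel

section Aggregation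

open Matrix

variable {r p m n : ℕ} {X : Matrix (Fin n) (Fin p) ℝ} {G : Finset (Fin p)} {c : ℝ}

lemma subY_mulVec_add (e : Fin n ≃ Fin m × Fin r) (X : Matrix (Fin n) (Fin p) ℝ)
    (β : Fin p → ℝ) (w : Fin n → ℝ) (i : Fin m) :
    subY e (X *ᵥ β + w) i = subX e X i *ᵥ β + subY e w i :=
  rfl

lemma aggregated_sub_apply (hm : 0 < m) (e : Fin n ≃ Fin m × Fin r) (Y : Fin n → ℝ)
    (β : Fin p → ℝ) (j : Fin p) : (aggregated e X Y G - β) j =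
      (∑ i, (ols (subX e X i) (subY e Y i) G - β) j) / m := by
  have hm' : (m : ℝ) ≠ 0 := Nat.cast_ne_zero.2 hm.ne'
  simp only [aggregated, Pi.sub_apply, Finset.sum_sub_distrib, Finset.sum_const, Finset.card_univ,
    Fintype.card_fin, nsmul_eq_mul]
  field_simp

lemma sqNorm_aggregated_sub_le (hm : 0 < m) (e : Fin n ≃ Fin m × Fin r) (Y : Fin n → ℝ)
    (β : Fin p → ℝ) : sqNorm (aggregated e X Y G - β) ≤
      (∑ i, sqNorm (ols (subX e X i) (subY e Y i) G - β)) / m := by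
  have hm' : (0 : ℝ) < m := Nat.cast_pos.2 hm
  simp only [sqNorm]
  rw [Finset.sum_comm, Finset.sum_div]
  refine Finset.sum_le_sum fun j _ => ?_
  rw [aggregated_sub_apply hm, div_pow, div_le_div_iff₀ (by positivity) hm']
  have hcs := sq_sum_le_card_mul_sum_sq (s := Finset.univ)
    (f := fun i => (ols (subX e X i) (subY e Y i) G - β) j)
  rw [Finset.card_univ, Fintype.card_fin] at hcs
  nlinarith [mul_le_mul_of_nonneg_left hcs hm'.le]

lemma aggregated_mulVec_add_sub_supp {β : Fin p → ℝ} (hm : 0 < m) (hc : 0 < c)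
    (e : Fin n ≃ Fin m × Fin r) (h : ∀ i, BoundedBelow (cols (subX e X i) (supp β)) c)
    (w : Fin n → ℝ) :
    aggregated e X (X *ᵥ β + w) (supp β) - β = aggregated e X w (supp β) := by
  ext j
  simp only [aggregated_sub_apply hm, subY_mulVec_add, (h _).ols_mulVec_add_sub_supp hc,
    aggregated]

/-- The weight of each observation in the coefficient `j` of the aggregated estimator. -/
noncomputable def aggWeight (e : Fin n ≃ Fin m × Fin r) (X : Matrix (Fin n) (Fin p) ℝ)
    (G : Finset (Fin p)) (j : G) : Fin n → ℝ :=
  fun x => lsWeight (cols (subX e X (e x).1) G) j (e x).2 / m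

lemma aggWeight_dotProduct (e : Fin n ≃ Fin m × Fin r) (j : G) (y : Fin n → ℝ) :
    aggWeight e X G j ⬝ᵥ y = (∑ i, lsCoef (cols (subX e X i) G) (subY e y i) j) / m := by
  rw [dotProduct, ← e.symm.sum_comp, Fintype.sum_prod_type, Finset.sum_div]
  refine Finset.sum_congr rfl fun i _ => ?_
  rw [lsCoef_apply, dotProduct, Finset.sum_div]
  refine Finset.sum_congr rfl fun l _ => ?_
  rw [aggWeight, Equiv.apply_symm_apply, subY]
  ring

lemma aggregated_eq (e : Fin n ≃ Fin m × Fin r) (y : Fin n → ℝ) :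
    aggregated e X y G = extendZero fun j => aggWeight e X G j ⬝ᵥ y := by
  ext j
  by_cases hj : j ∈ G
  · simp only [aggregated, extendZero, ols_eq, hj, dif_pos, aggWeight_dotProduct]
  · simp [aggregated, extendZero, ols_eq, hj]

lemma sqNorm_aggregated (e : Fin n ≃ Fin m × Fin r) (y : Fin n → ℝ) :
    sqNorm (aggregated e X y G) = ∑ j, (aggWeight e X G j ⬝ᵥ y) ^ 2 := by
  rw [aggregated_eq, sqNorm_extendZero, sqNorm]

lemma sqNorm_aggWeight_le (hm : 0 < m) (hc : 0 < c) (e : Fin n ≃ Fin m × Fin r)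
    (h : ∀ i, BoundedBelow (cols (subX e X i) G) c) (j : G) :
    sqNorm (aggWeight e X G j) ≤ 1 / (m * c) := by
  have : (0 : ℝ) < m := Nat.cast_pos.2 hm
  calc sqNorm (aggWeight e X G j)
      = ∑ i, sqNorm (lsWeight (cols (subX e X i) G) j) / m ^ 2 := by
        rw [sqNorm, ← e.symm.sum_comp, Fintype.sum_prod_type]
        refine Finset.sum_congr rfl fun i _ => ?_
        rw [sqNorm, Finset.sum_div]
        simp only [aggWeight, Equiv.apply_symm_apply, div_pow]
    _ ≤ ∑ _i : Fin m, 1 / c / m ^ 2 := by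
        gcongr with i
        exact (h i).sqNorm_lsWeight_le hc j
    _ = 1 / (m * c) := by
        rw [Finset.sum_const, Finset.card_univ, Fintype.card_fin, nsmul_eq_mul]
        field_simp

@[fun_prop]
lemma measurable_aggregated (e : Fin n ≃ Fin m × Fin r) (G : Finset (Fin p)) :
    Measurable fun y => aggregated e X y G := by
  refine measurable_pi_lambda _ fun j => ?_
  simp only [aggregated_eq]
  by_cases hj : j ∈ G
  · simp only [extendZero, hj, dif_pos, dotProduct]
    fun_prop
  · simp only [extendZero_of_notMem _ hj]
    fun_prop

end Aggregation

section Risk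

open Matrix

variable {Ω : Type*} [MeasurableSpace Ω] {μ : Measure Ω} {n p m r : ℕ} {k σ M : ℝ}
  {ε : Fin n → Ω → ℝ} {X : Matrix (Fin n) (Fin p) ℝ} {e : Fin n ≃ Fin m × Fin r}

lemma ErrorModel.measurable_sqNorm_aggregated_sub (h : ErrorModel μ k σ M ε) (β : Fin p → ℝ)
    {γ : Ω → Finset (Fin p)} (hγ : ∀ G, MeasurableSet {ω | γ ω = G}) :
    Measurable fun ω => sqNorm (aggregated e X (X *ᵥ β + fun l => ε l ω) (γ ω) - β) := by
  classical
  have hcases : (fun ω => sqNorm (aggregated e X (X *ᵥ β + fun l => ε l ω) (γ ω) - β)) =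
      fun ω => ∑ G, if γ ω = G then
        sqNorm (aggregated e X (X *ᵥ β + fun l => ε l ω) G - β) else 0 := by
    ext ω
    simp
  rw [hcases]
  refine Finset.measurable_fun_sum _ fun G _ => Measurable.ite (hγ G) ?_ measurable_const
  have hagg : Measurable fun ω => aggregated e X (X *ᵥ β + fun l => ε l ω) G :=
    (measurable_aggregated e G).comp (h.measurable_noise.const_add _)
  exact Finset.measurable_fun_sum _ fun j _ =>
    (((measurable_pi_apply j).comp hagg).sub_const (β j)).pow_const 2

lemma ErrorModel.integrable_sqNorm_aggregated (h : ErrorModel μ k σ M ε) (G : Finset (Fin p)) :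
    Integrable (fun ω => sqNorm (aggregated e X (fun l => ε l ω) G)) μ := by
  simp only [sqNorm_aggregated]
  exact integrable_finsetSum _ fun j _ => (h.memLp_sum (aggWeight e X G j)).integrable_sq

lemma ErrorModel.integral_sqNorm_aggregated_le [IsProbabilityMeasure μ]
    (h : ErrorModel μ k σ M ε) {G : Finset (Fin p)} {c : ℝ} (hm : 0 < m) (hc : 0 < c)
    (hX : ∀ i, BoundedBelow (cols (subX e X i) G) c) :
    ∫ ω, sqNorm (aggregated e X (fun l => ε l ω) G) ∂μ ≤ σ ^ 2 * G.card / (m * c) := by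
  simp only [sqNorm_aggregated, dotProduct]
  rw [integral_finsetSum _ fun j _ => (h.memLp_sum (aggWeight e X G j)).integrable_sq]
  simp only [h.integral_sum_sq]
  calc ∑ j, σ ^ 2 * sqNorm (aggWeight e X G j) ≤ ∑ _j : G, σ ^ 2 * (1 / (m * c)) := by
        gcongr with j
        exact sqNorm_aggWeight_le hm hc e hX j
    _ = σ ^ 2 * G.card / (m * c) := by
        rw [Finset.sum_const, Finset.card_univ, Fintype.card_coe, nsmul_eq_mul]
        ring

lemma integrable_and_integral_le_add_setIntegral {f g h : Ω → ℝ} {B : Set Ω}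
    (hB : MeasurableSet B) (hf : AEStronglyMeasurable f μ) (hf0 : 0 ≤ f) (hg : Integrable g μ)
    (hg0 : 0 ≤ g) (hh : IntegrableOn h B μ) (hoff : ∀ ω ∉ B, f ω ≤ g ω)
    (hon : ∀ᵐ ω ∂μ, ω ∈ B → f ω ≤ h ω) :
    Integrable f μ ∧ ∫ ω, f ω ∂μ ≤ ∫ ω, g ω ∂μ + ∫ ω in B, h ω ∂μ := by
  have hhB : Integrable (B.indicator h) μ := (integrable_indicator_iff hB).2 hh
  have hle : f ≤ᵐ[μ] g + B.indicator h := by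
    filter_upwards [hon] with ω hω
    by_cases hωB : ω ∈ B
    · simpa [hωB] using (hω hωB).trans (le_add_of_nonneg_left (hg0 ω))
    · simpa [hωB] using hoff ω hωB
  constructor
  · refine (hg.add hhB).mono' hf (hle.mono fun ω hω => ?_)
    rwa [Real.norm_of_nonneg (hf0 ω)]
  · rw [← integral_indicator hB, ← integral_add hg hhB]
    exact integral_mono_of_nonneg (.of_forall hf0) (hg.add hhB) hle

lemma sqNorm_aggregated_sub_le_fittedEnergy {V₁ V₂ C : ℝ} {β : Fin p → ℝ} {G : Finset (Fin p)}
    (hm : 0 < m) (hr : 0 < r) (hV₁ : 0 ≤ V₁) (hC : 0 < C)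
    (hA1 : ∀ i, CondA1 V₁ V₂ (subX e X i) β)
    (heig : ∀ i, MinEigenvalueGE ((1 / (r : ℝ)) • gram (subX e X i) G) C) (w : Fin n → ℝ) :
    sqNorm (aggregated e X (X *ᵥ β + w) G - β) ≤
      (1 + 2 * C⁻¹ * (supp β).card * V₁) * sqNorm β +
        2 / (m * r * C) * ∑ i, fittedEnergy (subX e X i) (subY e w i) := by
  have hm' : (0 : ℝ) < m := Nat.cast_pos.2 hm
  have hr' : (0 : ℝ) < r := Nat.cast_pos.2 hr
  have hblock : ∀ i, sqNorm (ols (subX e X i) (subY e (X *ᵥ β + w) i) G - β) ≤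
      (1 + 2 * (supp β).card * (r * V₁) / (r * C)) * sqNorm β +
        2 / (r * C) * fittedEnergy (subX e X i) (subY e w i) := fun i =>
    ((heig i).boundedBelow hr').sqNorm_ols_sub_le (by positivity) ((hA1 i).sqNorm_col_le hr)
      (by positivity) β _
  refine (sqNorm_aggregated_sub_le hm e _ β).trans ?_
  rw [div_le_iff₀ hm']
  refine (Finset.sum_le_sum fun i _ => hblock i).trans_eq ?_
  rw [Finset.sum_add_distrib, ← Finset.mul_sum, Finset.sum_const, Finset.card_univ,
    Fintype.card_fin, nsmul_eq_mul, ← Finset.mul_sum]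
  field_simp

lemma ErrorModel.block (h : ErrorModel μ k σ M ε) (e : Fin n ≃ Fin m × Fin r) (i : Fin m) :
    ErrorModel μ k σ M fun l => ε (e.symm (i, l)) :=
  h.precomp (e.symm.injective.comp (Prod.mk_right_injective i))

lemma ErrorModel.integrable_fittedEnergy_subY (h : ErrorModel μ k σ M ε) (i : Fin m) :
    Integrable (fun ω => fittedEnergy (subX e X i) (subY e (fun l => ε l ω) i)) μ :=
  (h.block e i).integrable_fittedEnergy _

lemma ErrorModel.setIntegral_const_add_sum_fittedEnergy_le (h : ErrorModel μ k σ M ε)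
    [IsProbabilityMeasure μ] {B : Set Ω} {a q ρ C : ℝ} (hm : 0 < m) (hr : 0 < r) (ha : 0 ≤ a)
    (hC : 0 < C) (hqρ : 2 * q ≤ ρ) (hB : μ.real B ≤ q)
    (hE : ∀ i, ∫ ω in B, fittedEnergy (subX e X i) (subY e (fun l => ε l ω) i) ∂μ ≤
      q * (r * σ ^ 2)) :
    ∫ ω in B, (a + 2 / (m * r * C) *
      ∑ i, fittedEnergy (subX e X i) (subY e (fun l => ε l ω) i)) ∂μ ≤
      ρ * (a + C⁻¹ * σ ^ 2) := by
  have : (0 : ℝ) < m := Nat.cast_pos.2 hm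
  have : (0 : ℝ) < r := Nat.cast_pos.2 hr
  have hint : ∀ i, IntegrableOn
      (fun ω => fittedEnergy (subX e X i) (subY e (fun l => ε l ω) i)) B μ :=
    fun i => (h.integrable_fittedEnergy_subY i).integrableOn
  rw [integral_add (integrable_const a)
      ((integrable_finsetSum _ fun i _ => hint i).const_mul _),
    setIntegral_const, smul_eq_mul, integral_const_mul, integral_finsetSum _ fun i _ => hint i]
  calc μ.real B * a + 2 / (m * r * C) *
        ∑ i, ∫ ω in B, fittedEnergy (subX e X i) (subY e (fun l => ε l ω) i) ∂μ
      ≤ q * a + 2 / (m * r * C) * ∑ _i : Fin m, q * (r * σ ^ 2) := by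
        gcongr with i
        exact hE i
    _ = q * a + 2 * q * (C⁻¹ * σ ^ 2) := by
        rw [Finset.sum_const, Finset.card_univ, Fintype.card_fin, nsmul_eq_mul]
        field_simp
    _ ≤ ρ * a + ρ * (C⁻¹ * σ ^ 2) := by
        gcongr
        linarith [measureReal_nonneg.trans hB]
    _ = ρ * (a + C⁻¹ * σ ^ 2) := (mul_add _ _ _).symm

lemma ErrorModel.risk_le [IsProbabilityMeasure μ] (h : ErrorModel μ k σ M ε) {V₁ V₂ C q ρ : ℝ}
    {β : Fin p → ℝ} {γ : Ω → Finset (Fin p)} (hm : 0 < m) (hr : 0 < r) (hV₁ : 0 ≤ V₁)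
    (hV₂ : 0 < V₂) (hC : 0 < C) (hA1 : ∀ i, CondA1 V₁ V₂ (subX e X i) β)
    (hγ : ∀ G, MeasurableSet {ω | γ ω = G})
    (heig : ∀ᵐ ω ∂μ, ∀ i, MinEigenvalueGE ((1 / (r : ℝ)) • gram (subX e X i) (γ ω)) C)
    {B : Set Ω} (hB : MeasurableSet B) (hγB : ∀ ω ∉ B, γ ω = supp β) (hqρ : 2 * q ≤ ρ)
    (hPB : μ.real B ≤ q)
    (hE : ∀ i, ∫ ω in B, fittedEnergy (subX e X i) (subY e (fun l => ε l ω) i) ∂μ ≤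
      q * (r * σ ^ 2)) :
    Integrable (fun ω => sqNorm (aggregated e X (X *ᵥ β + fun l => ε l ω) (γ ω) - β)) μ ∧
    ∫ ω, sqNorm (aggregated e X (X *ᵥ β + fun l => ε l ω) (γ ω) - β) ∂μ ≤
      σ ^ 2 * V₂⁻¹ * (supp β).card / (m * r) +
        ρ * ((1 + 2 * C⁻¹ * (supp β).card * V₁) * sqNorm β + C⁻¹ * σ ^ 2) := by
  have hX := fun i => (hA1 i).boundedBelow hr
  have hrV : 0 < r * V₂ := by positivity
  have hloss := integrable_and_integral_le_add_setIntegral hB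
    (h.measurable_sqNorm_aggregated_sub β hγ).aestronglyMeasurable
    (fun ω => sqNorm_nonneg _) (h.integrable_sqNorm_aggregated (supp β))
    (fun ω => sqNorm_nonneg _)
    (((integrable_const _).add ((integrable_finsetSum _ fun i _ =>
      h.integrable_fittedEnergy_subY i).const_mul _)).integrableOn)
    (fun ω hω => by rw [hγB ω hω, aggregated_mulVec_add_sub_supp hm hrV e hX])
    (heig.mono fun ω hω _ =>
      sqNorm_aggregated_sub_le_fittedEnergy hm hr hV₁ hC hA1 hω fun l => ε l ω)
  refine ⟨hloss.1, hloss.2.trans (add_le_add ?_ ?_)⟩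
  · refine (h.integral_sqNorm_aggregated_le hm hrV hX).trans_eq ?_
    field_simp
  · exact h.setIntegral_const_add_sum_fittedEnergy_le hm hr
      (mul_nonneg (by positivity) (sqNorm_nonneg β)) hC hqρ hPB hE

end Risk

section ExceptionalEvent

open Matrix

variable {Ω : Type*} {n p m r : ℕ}
  {k σ M τ ι V₁ V₂ c₀ c₁ c₂ η δ : ℝ} {ε : Fin n → Ω → ℝ} {e : Fin n ≃ Fin m × Fin r}
  {X : Matrix (Fin n) (Fin p) ℝ} {β : Fin p → ℝ}

/-- The event that on at least half of the blocks the noise is bad; the remaining blocks determine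
the median model. -/
def badEvent (τ ι V₂ c₀ c₁ c₂ η : ℝ) (e : Fin n ≃ Fin m × Fin r) (X : Matrix (Fin n) (Fin p) ℝ)
    (β : Fin p → ℝ) (ε : Fin n → Ω → ℝ) : Set Ω :=
  majority fun i => (fun ω => subY e (fun l => ε l ω) i) ⁻¹'
    badNoise τ ι V₂ c₀ c₁ c₂ η (subX e X i) β

lemma IsMedianModel.eq_supp_of_notMem_badEvent {ω : Ω} {b : Fin m → Fin p → ℝ}
    {G : Finset (Fin p)} (hG : IsMedianModel (fun i => supp (b i)) G) (hr : 0 < r) (hV₂ : 0 < V₂)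
    (hc₁ : 0 < c₁) (hc₀ : 0 < c₀) (hA1 : ∀ i, CondA1 V₁ V₂ (subX e X i) β)
    (hA2 : CondA2 c₁ c₂ ι τ r β) (hA3 : ∀ i, CondA3 η (subX e X i) β)
    (hb : ∀ i, IsLasso (penalty c₀ ι τ r) (subX e X i)
      (subY e (X *ᵥ β + fun l => ε l ω) i) (b i))
    (hω : ω ∉ badEvent τ ι V₂ c₀ c₁ c₂ η e X β ε) : G = supp β := by
  have hgood := lt_two_mul_card_of_notMem_majority hω (P := fun i => supp (b i) = supp β)
    fun i hi => (hb i).supp_eq_of_notMem_badNoise hr hV₂ hc₁ hc₀ (hA1 i) hA2 (hA3 i) hi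
  rw [Fintype.card_fin] at hgood
  exact hG.eq_of_lt_two_mul_card hgood

variable [MeasurableSpace Ω] {μ : Measure Ω}

lemma ErrorModel.measurable_subY (h : ErrorModel μ k σ M ε) (i : Fin m) :
    Measurable fun ω => subY e (fun l => ε l ω) i :=
  (h.block e i).measurable_noise

lemma ErrorModel.iIndepFun_subY (h : ErrorModel μ k σ M ε) :
    iIndepFun (fun i ω => subY e (fun l => ε l ω) i) μ :=
  iIndepFun_curry (X := fun q => ε (e.symm q)) (h.indep.precomp e.symm.injective)
    fun _ => h.meas _

lemma ErrorModel.measurableSet_badEvent (h : ErrorModel μ k σ M ε) :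
    MeasurableSet (badEvent τ ι V₂ c₀ c₁ c₂ η e X β ε) :=
  measurableSet_majority fun i => h.measurable_subY i measurableSet_failSet

lemma ErrorModel.measureReal_badEvent_le (h : ErrorModel μ k σ M ε)
    (hP : ∀ i, μ.real ((fun ω => subY e (fun l => ε l ω) i) ⁻¹'
      badNoise τ ι V₂ c₀ c₁ c₂ η (subX e X i) β) ≤ 1 / 64) :
    μ.real (badEvent τ ι V₂ c₀ c₁ c₂ η e X β ε) ≤ (1 / 4) ^ m := by
  refine (measureReal_majority_le h.iIndepFun_subY h.measurable_subY
    (fun _ => measurableSet_failSet) (s := 1 / 8) (by norm_num) (by norm_num)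
    fun i => (hP i).trans (by norm_num)).trans_eq ?_
  rw [Fintype.card_fin]
  norm_num

variable [IsProbabilityMeasure μ]

lemma ErrorModel.measureReal_block_badNoise_le_and_mul_le (h : ErrorModel μ k σ M ε) (hk : 0 < k)
    (hι : 0 ≤ ι) (hr : 0 < r) (hV₁ : 0 ≤ V₁) (hV₂ : 0 < V₂) (hη : 0 < η) (hc₀ : 0 < c₀)
    (hg : 0 < signalGap V₂ c₀ c₁ c₂) (hA1 : ∀ i, CondA1 V₁ V₂ (subX e X i) β) (hδ : δ ≤ 1)
    (hpr : (p : ℝ) ≤ δ / recoveryConst k σ M V₁ V₂ c₀ c₁ c₂ η * (r : ℝ) ^ (k * τ - k * ι))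
    (i : Fin m) :
    μ.real ((fun ω => subY e (fun l => ε l ω) i) ⁻¹'
      badNoise τ ι V₂ c₀ c₁ c₂ η (subX e X i) β) ≤ 1 / 64 ∧
    μ.real ((fun ω => subY e (fun l => ε l ω) i) ⁻¹'
      badNoise τ ι V₂ c₀ c₁ c₂ η (subX e X i) β) * truncConst k σ M ≤ 1 := by
  set P := μ.real ((fun ω => subY e (fun l => ε l ω) i) ⁻¹'
    badNoise τ ι V₂ c₀ c₁ c₂ η (subX e X i) β)
  have hT := truncConst_nonneg k σ M
  have hP0 : 0 ≤ P := measureReal_nonneg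
  have hP : P ≤ _ :=
    (h.block e i).measureReal_badNoise_le hk hι hr hV₁ hV₂ hη hc₀ hg (hA1 i)
  have hsum : P * (64 + truncConst k σ M) ≤ 1 :=
    (mul_le_mul_of_nonneg_right hP (by positivity)).trans
      (mul_rate_le_one hr (tailConst_pos k σ M).le (rateConst_pos hV₁ hV₂ hg).le (by positivity)
        hδ hpr)
  constructor <;> nlinarith [mul_nonneg hP0 hT]

lemma ErrorModel.setIntegral_badEvent_fittedEnergy_le (h : ErrorModel μ k σ M ε)
    (hcard : k ≤ 1 → (p : ℝ) ≤ r / 64)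
    (hP : ∀ i, μ.real ((fun ω => subY e (fun l => ε l ω) i) ⁻¹'
      badNoise τ ι V₂ c₀ c₁ c₂ η (subX e X i) β) ≤ 1 / 64)
    (hPT : ∀ i, μ.real ((fun ω => subY e (fun l => ε l ω) i) ⁻¹'
      badNoise τ ι V₂ c₀ c₁ c₂ η (subX e X i) β) * truncConst k σ M ≤ 1) (i : Fin m) :
    ∫ ω in badEvent τ ι V₂ c₀ c₁ c₂ η e X β ε,
      fittedEnergy (subX e X i) (subY e (fun l => ε l ω) i) ∂μ ≤ (1 / 4) ^ m * (r * σ ^ 2) := by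
  have hblock := h.block e i
  refine (setIntegral_majority_le h.iIndepFun_subY h.measurable_subY
    (fun _ => measurableSet_failSet) (s := 1 / 8) (by norm_num) (by norm_num)
    (fun i => (hP i).trans (by norm_num)) (measurable_fittedEnergy (subX e X i))
    (fun _ => fittedEnergy_nonneg _ _) i (h.integrable_fittedEnergy_subY i)
    ((hblock.setIntegral_fittedEnergy_le (subX e X i) (by simpa using hcard) (hPT i)).trans_eq
      (by ring)) (hblock.integral_fittedEnergy_le (subX e X i))).trans_eq ?_
  rw [Fintype.card_fin]
  norm_num

end ExceptionalEvent

section NumberOfBlocks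

lemma eq_mul_of_equiv {n m r : ℕ} (e : Fin n ≃ Fin m × Fin r) : n = m * r := by
  simpa only [Fintype.card_fin, Fintype.card_prod] using Fintype.card_congr e

lemma pos_and_le_mul_rpow_of_eq_floor {κ A : ℝ} {p m r : ℕ} (hκ : 0 < κ) (hA : 0 ≤ A)
    (hm : m = ⌊A ^ κ⁻¹ * (m * r : ℕ) / (p : ℝ) ^ κ⁻¹⌋₊) (hm1 : 1 ≤ m) :
    0 < r ∧ 0 < p ∧ (p : ℝ) ≤ A * (r : ℝ) ^ κ := by
  have hle : (m : ℝ) ≤ A ^ κ⁻¹ * (m * r : ℕ) / (p : ℝ) ^ κ⁻¹ := by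
    conv_lhs => rw [hm]
    exact Nat.floor_le (by positivity)
  obtain ⟨hn, hp⟩ := pos_of_one_le_floor_arg hκ.ne' ((Nat.one_le_cast.2 hm1).trans hle)
  exact ⟨Nat.pos_of_mul_pos_left hn, hp, le_mul_rpow_of_mul_le hκ hA hp hm1 hle⟩

lemma two_mul_quarter_pow_le_failBound {C₀ δ k τ ι α : ℝ} {n p m : ℕ} (hC₀ : 0 ≤ C₀) (hδ : 0 ≤ δ)
    (hδ' : δ ≤ 1 / 2) (hκ : 0 ≤ k * τ - k * ι) (hn : 0 < n) (hp : 0 < p)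
    (hpα : (p : ℝ) ≤ (n : ℝ) ^ α) (hm1 : 1 ≤ m)
    (hm : m = ⌊(δ / C₀) ^ (k * τ - k * ι)⁻¹ * (n : ℝ) / (p : ℝ) ^ (k * τ - k * ι)⁻¹⌋₊) :
    2 * (1 / 4 : ℝ) ^ m ≤ failBound C₀ δ k τ ι α n :=
  (two_mul_quarter_pow_le hm1).trans (half_pow_le_failBound hC₀ hδ hδ' hκ hn hp hpα hm1
    (by conv_rhs => rw [hm]
        exact Nat.lt_floor_add_one _))

lemma le_div_of_le_div_mul_rpow {k τ ι δ C₀ x : ℝ} {r : ℕ} (hr : 0 < r) (hk : 0 < k)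
    (hι : 0 ≤ ι) (hτ : τ ≤ 1) (hC₀ : 64 ≤ C₀) (hδ : δ ≤ 1)
    (hx : x ≤ δ / C₀ * (r : ℝ) ^ (k * τ - k * ι)) (hk1 : k ≤ 1) : x ≤ r / 64 := by
  have hκ : k * τ - k * ι ≤ 1 := by nlinarith
  have hA : δ / C₀ ≤ 1 / 64 := by
    rw [div_le_div_iff₀ (by linarith) (by norm_num)]
    linarith
  exact (le_mul_of_le_mul_rpow hr hκ hA (by norm_num) hx).trans_eq (by ring)

end NumberOfBlocks

end Message

theorem theorem2 (k τ ι V₁ V₂ c₀ c₁ c₂ η σ M : ℝ)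
    (hk : 0 < k) (hι : 0 ≤ ι) (hιτ : ι < τ) (hτ : τ ≤ 1)
    (hV₁ : 0 < V₁) (hV₂ : 0 < V₂) (hc₁ : 0 < c₁) (hc₂ : 0 < c₂) (hη : 0 < η)
    (hc₀ : 0 < c₀) (hc₀' : c₀ < 2 * c₂ * V₂ / Real.sqrt c₁) :
    ∃ C₀ : ℝ, 0 < C₀ ∧
      ∀ (n p m r : ℕ) (α δ : ℝ) (e : Fin n ≃ Fin m × Fin r)
        (X : Matrix (Fin n) (Fin p) ℝ) (β : Fin p → ℝ)
        {Ω : Type*} [MeasurableSpace Ω] (μ : Measure Ω) [IsProbabilityMeasure μ]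
        (ε : Fin n → Ω → ℝ) (Y : Ω → Fin n → ℝ)
        (b : Fin m → Ω → Fin p → ℝ) (γ : Ω → Finset (Fin p)),
        α < k * (τ - ι) → (p : ℝ) ≤ (n : ℝ) ^ α →
        0 < δ → δ < 1 / 2 →
        (2 * C₀ * (p : ℝ)) ^ (k * τ - k * ι)⁻¹ ≤ (n : ℝ) →
        m = ⌊(δ / C₀) ^ (k * τ - k * ι)⁻¹ * (n : ℝ) / (p : ℝ) ^ (k * τ - k * ι)⁻¹⌋₊ →
        1 ≤ m →
        Message.ErrorModel μ k σ M ε →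
        (∀ ω, Y ω = X.mulVec β + fun l => ε l ω) →
        (∀ i, Message.CondA1 V₁ V₂ (Message.subX e X i) β) →
        Message.CondA2 c₁ c₂ ι τ r β →
        (∀ i, Message.CondA3 η (Message.subX e X i) β) →
        (∀ i ω, Message.IsLasso (c₀ * ((n : ℝ) / (m : ℝ)) ^ (-((ι - τ + 1) / 2)))
          (Message.subX e X i) (Message.subY e (Y ω) i) (b i ω)) →
        (∀ ω, Message.IsMedianModel (fun i => Message.supp (b i ω)) (γ ω)) →
        (∀ G, MeasurableSet {ω | γ ω = G}) →
        1 - Message.failBound C₀ δ k τ ι α n ≤ μ.real {ω | γ ω = Message.supp β} ∧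
        ∀ C' : ℝ, 0 < C' →
          (∀ᵐ ω ∂μ, ∀ i, Message.MinEigenvalueGE
            ((1 / (r : ℝ)) • Message.gram (Message.subX e X i) (γ ω)) C') →
          Integrable
            (fun ω => Message.sqNorm (Message.aggregated e X (Y ω) (γ ω) - β)) μ ∧
          ∫ ω, Message.sqNorm (Message.aggregated e X (Y ω) (γ ω) - β) ∂μ ≤
            σ ^ 2 * V₂⁻¹ * ((Message.supp β).card : ℝ) / (n : ℝ) +
              Message.failBound C₀ δ k τ ι α n *
                ((1 + 2 * C'⁻¹ * ((Message.supp β).card : ℝ) * V₁) * Message.sqNorm β +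
                  C'⁻¹ * σ ^ 2) := by
  have hg := Message.signalGap_pos hc₁ hV₂ hc₀'
  have hC₀ := Message.recoveryConst_ge (k := k) (σ := σ) (M := M) (η := η) hV₁.le hV₂ hg
  refine ⟨Message.recoveryConst k σ M V₁ V₂ c₀ c₁ c₂ η, by linarith, ?_⟩
  intro n p m r α δ e X β Ω _ μ _ ε Y b γ _ hpα hδ hδ' _ hm hm1 hε hY hA1 hA2 hA3 hb hγ hγm
  obtain rfl := Message.eq_mul_of_equiv e
  have hκ : 0 < k * τ - k * ι := sub_pos.2 (mul_lt_mul_of_pos_left hιτ hk)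
  obtain ⟨hr, hp, hpr⟩ := Message.pos_and_le_mul_rpow_of_eq_floor hκ (by positivity) hm hm1
  have hρ := Message.two_mul_quarter_pow_le_failBound (by positivity) hδ.le hδ'.le hκ.le
    (Nat.mul_pos hm1 hr) hp hpα hm1 hm
  have hmr : ((m * r : ℕ) : ℝ) / m = r := by
    rw [Nat.cast_mul, mul_div_cancel_left₀ _ (Nat.cast_ne_zero.2 (Nat.one_le_iff_ne_zero.1 hm1))]
  simp only [hY, hmr] at hb ⊢
  have hblock := hε.measureReal_block_badNoise_le_and_mul_le hk hι hr hV₁.le hV₂ hη hc₀ hg hA1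
    (by linarith) hpr
  set B := Message.badEvent τ ι V₂ c₀ c₁ c₂ η e X β ε
  have hB : MeasurableSet B := hε.measurableSet_badEvent
  have hPB : μ.real B ≤ (1 / 4) ^ m := hε.measureReal_badEvent_le fun i => (hblock i).1
  have hγB : ∀ ω ∉ B, γ ω = Message.supp β := fun ω hω =>
    (hγ ω).eq_supp_of_notMem_badEvent hr hV₂ hc₁ hc₀ hA1 hA2 hA3 (fun i => hb i ω) hω
  refine ⟨?_, fun C' hC' heig => ?_⟩
  · have hrec : μ.real Bᶜ ≤ μ.real {ω | γ ω = Message.supp β} := measureReal_mono hγB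
    rw [probReal_compl_eq_one_sub hB] at hrec
    linarith [measureReal_nonneg (μ := μ) (s := B)]
  · have hcard : k ≤ 1 → (p : ℝ) ≤ r / 64 :=
      Message.le_div_of_le_div_mul_rpow hr hk hι hτ hC₀ (by linarith) hpr
    rw [Nat.cast_mul]
    exact hε.risk_le hm1 hr hV₁.le hV₂ hC' hA1 hγm heig hB hγB hρ hPB
      (hε.setIntegral_badEvent_fittedEnergy_le hcard (fun i => (hblock i).1)
        fun i => (hblock i).2)
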